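/- Let $k,n$ be integers with $1\le k<n/2$, and let $X$ be a $k$-flat process in $\mathbb R^n$, i.e. a simple, locally finite point process on the space $A(n,k)$ of $k$-dimensional affine subspaces of $\mathbb R^n$. Assume that its intensity measure $\Theta=\mathbb E X$ is locally finite, i.e. $\Theta(\{E:E\cap K\neq\emptyset\})<\infty$ for all compact $K\subset\mathbb R^n$, that $X$ is weakly stationary, i.e. $\Theta$ is translation invariant, and that $X$ is of type $(S_2)$, i.e. $\mathbb E\sum_{(E,F)\in X^2_{\neq}}\mathbf 1\{(E,F)\in S\}=(\Theta\otimes\Theta)(S)$ for all measurable $S\subset A(n,k)^2$, where $X^2_{\ne}$ denotes the set of pairs of distinct flats of $X$. Let $\gamma=\kappa_{n-k}^{-1}\,\Theta(\{E:E\cap B^n\ne\emptyset\})$ be the intensity of $X$, and let $Q$ be its directional distribution: a probability measure on the Grassmannian $G(n,k)$ with $Q(D)=\Theta(\{E:E\cap B^n\neq\emptyset,\ L(E)\in D\})/\Theta(\{E:E\cap B^n\neq\emptyset\})$ for Borel sets $D$ if $\gamma\neq0$, and an arbitrary probability measure on $G(n,k)$ if $\gamma=0$. Here $B^m$ is the closed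 unit ball of $\mathbb R^m$, $\kappa_m$ its volume, $\omega_m=m\kappa_m$, and $L(E)$ is the linear subspace parallel to $E$. For $L,M\in G(n,k)$, let $[L,M]$ be the $2k$-volume of the parallelepiped spanned by an orthonormal basis of $L$ and an orthonormal basis of $M$, and put $[E,F]=[L(E),L(F)]$ for $E,F\in A(n,k)$. For a linear subspace $U$, let $\sigma_U$ be the spherical Lebesgue measure on the unit sphere of $U$. Let $\ell$ be the Lebesgue measure on $\mathbb R^n$, and let $\mathcal H^0$ be the counting measure. If $[E,F]>0$, let $x_E\in E$, $x_F\in F$ be the unique points with $\|x_E-x_F\|=d(E,F):=\inf\{\|x-y\|:x\in E,y\in F\}$, let $m(E,F)=(x_E+x_F)/2$, and let $\phi(E,F)$ be the linear span of $x_F-x_E$. For $\delta>0$, the proximity process $\Phi$ of $X$ with distance threshold $\delta$ is the random measure on $\mathbb R^n\times(0,\infty)\times\mathbb S^{n-1}$ with $$\Phi(A\times B\times C)=\frac12\sum_{(E,F)\in X^2_{\neq}}\mathbf 1\{[E,F]>0,\ 0<d(E,F)\le\delta,\ m(E,F)\in A,\ d(E,F)\in B\}\,\frac12\mathcal H^0(\phi(E,F)\cap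 C),$$ and $\Lambda=\mathbb E\Phi$ is its intensity measure. The proximity of $X$ is $\pi(X,\delta)=\kappa_n^{-1}\Lambda(B^n\times(0,\infty)\times\mathbb S^{n-1})$, and, if $\pi(X,\delta)\ne0$, the directional distribution of $\Phi$ is $\mathcal R(C)=\Lambda(B^n\times(0,\infty)\times C)/\Lambda(B^n\times(0,\infty)\times\mathbb S^{n-1})$. Then $\Phi$ is indeed a random measure (it depends measurably on the random outcome), and the following hold. (a) For all Borel sets $A\subset\mathbb R^n$, $B\subset(0,\delta]$, $C\subset\mathbb S^{n-1}$, $$\Lambda(A\times B\times C)=\frac{\gamma^2}{2}\,\ell(A)\int_B t^{n-2k-1}\,dt\int_{G(n,k)}\int_{G(n,k)}[L,M]\,\sigma_{(L+M)^\perp}\big(C\cap(L+M)^\perp\big)\,Q(dM)\,Q(dL).$$ (b) $\displaystyle \pi(X,\delta)=\frac{\gamma^2}{2}\,\kappa_{n-2k}\,\delta^{n-2k}\int_{G(n,k)}\int_{G(n,k)}[L,M]\,Q(dM)\,Q(dL).$ (c) If $\pi(X,\delta)\neq0$, then for every Borel set $C\subset\mathbb S^{n-1}$, $$\mathcal R(C)=\frac{\int_{G(n,k)}\int_{G(n,k)}[L,M]\,\sigma_{(L+M)^\perp}(C\cap(L+M)^\perp)\,Q(dM)\,Q(dL)}{\omega_{n-2k}\int_{G(n,k)}\int_{G(n,k)}[L,M]\,Q(dM)\,Q(dL)}.$$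 In particular, $\mathcal R$ does not depend on $\delta$: for every $\delta'>0$ one also has $\pi(X,\delta')\neq0$, and the directional distribution for the threshold $\delta'$ equals that for $\delta$. -/

import Mathlib

open MeasureTheory
open scoped ENNReal

noncomputable section

namespace FlatProximity

/-- The Euclidean space `ℝⁿ`. -/
abbrev Eucl (n : ℕ) : Type := EuclideanSpace ℝ (Fin n)

/-- The unit sphere of `ℝⁿ`. -/
abbrev USphere (n : ℕ) : Type := Metric.sphere (0 : Eucl n) 1

/-! ### Grassmannians -/

/-- `G(n,k)`: the `k`-dimensional linear subspaces of `ℝⁿ`. -/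
structure Grass (n k : ℕ) where
  /-- the underlying linear subspace -/
  space : Submodule ℝ (Eucl n)
  finrank_eq : Module.finrank ℝ space = k

/-- `A(n,k)`: the `k`-dimensional affine subspaces (`k`-flats) of `ℝⁿ`. -/
structure Flat (n k : ℕ) where
  /-- the underlying affine subspace -/
  space : AffineSubspace ℝ (Eucl n)
  nonempty : (space : Set (Eucl n)).Nonempty
  finrank_eq : Module.finrank ℝ space.direction = k

namespace Flat

variable {n k : ℕ}

instance (F : Flat n k) : Nonempty F.space := F.nonempty.to_subtype

/-- `L(F)`: the linear subspace parallel to `F`. -/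
def dir (F : Flat n k) : Grass n k := ⟨F.space.direction, F.finrank_eq⟩

/-- The point of `F` closest to the origin, i.e. the `x ∈ L(F)ᗮ` with `F = L(F) + x`. -/
def foot (F : Flat n k) : Eucl n := EuclideanGeometry.orthogonalProjection F.space 0

/-- The flat `F` meets the set `K`. -/
def Hits (F : Flat n k) (K : Set (Eucl n)) : Prop := ((F.space : Set (Eucl n)) ∩ K).Nonempty

/-- The translated flat `F + z`. -/
def translate (z : Eucl n) (F : Flat n k) : Flat n k where
  space := F.space.map (AffineEquiv.constVAdd ℝ (Eucl n) z).toAffineMap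
  nonempty := by
    rw [AffineSubspace.coe_map]
    exact F.nonempty.image _
  finrank_eq := by
    rw [AffineSubspace.map_direction]
    have h : (AffineEquiv.constVAdd ℝ (Eucl n) z).toAffineMap.linear = LinearMap.id := by
      ext v; simp
    rw [h, Submodule.map_id]
    exact F.finrank_eq

end Flat

/-- The natural topology of `G(n,k)`: subspaces are close if and only if their orthogonal
projections are close in operator norm. -/
instance (n k : ℕ) : TopologicalSpace (Grass n k) :=
  TopologicalSpace.induced (fun L => L.space.starProjection) inferInstance

/-- The natural topology of `A(n,k)`: flats `L + x` with `x ∈ Lᗮ` are close if and only if the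
linear subspaces `L` are close and the points `x` are close. -/
instance (n k : ℕ) : TopologicalSpace (Flat n k) :=
  TopologicalSpace.induced (fun F => (F.dir, F.foot)) inferInstance

instance (n k : ℕ) : MeasurableSpace (Grass n k) := borel _
instance (n k : ℕ) : BorelSpace (Grass n k) := ⟨rfl⟩
instance (n k : ℕ) : MeasurableSpace (Flat n k) := borel _
instance (n k : ℕ) : BorelSpace (Flat n k) := ⟨rfl⟩

/-! ### Geometry of linear subspaces and of pairs of flats -/

/-- `κ_m`: the volume of the unit ball of `ℝᵐ`. -/
def kappa (m : ℕ) : ℝ≥0∞ := volume (Metric.closedBall (0 : Eucl m) 1)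

/-- `ω_m = m κ_m`: the surface area of the unit sphere of `ℝᵐ`. -/
def omega (m : ℕ) : ℝ≥0∞ := m * kappa m

/-- The `|ι|`-dimensional volume of the parallelepiped spanned by the vectors `v i`, as the square
root of their Gram determinant. -/
def spannedVolume {n : ℕ} {ι : Type*} [Fintype ι] [DecidableEq ι] (v : ι → Eucl n) : ℝ :=
  Real.sqrt (Matrix.gram ℝ v).det

/-- The subspace determinant `[L, M]` of two linear subspaces with `dim L + dim M ≤ n`: the volume
of the parallelepiped spanned by an orthonormal basis of `L` together with an orthonormal basis
of `M` (which does not depend on the choice of the bases). -/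
def subspaceDet {n : ℕ} (L M : Submodule ℝ (Eucl n)) : ℝ :=
  spannedVolume (Sum.elim (fun i => (stdOrthonormalBasis ℝ L i : Eucl n))
    (fun j => (stdOrthonormalBasis ℝ M j : Eucl n)))

/-- The inclusion of the unit sphere of a linear subspace `U` into the unit sphere of `ℝⁿ`. -/
def sphereIncl {n : ℕ} (U : Submodule ℝ (Eucl n)) (u : Metric.sphere (0 : U) 1) : USphere n :=
  ⟨((u : U) : Eucl n), by
    have h := u.2
    rw [mem_sphere_zero_iff_norm] at h ⊢
    exact h⟩

/-- `C ↦ σ_U(C ∩ U)`: the spherical Lebesgue measure of the unit sphere of `U`, as a measure on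
the unit sphere of `ℝⁿ`. -/
def sphMeasure {n : ℕ} (U : Submodule ℝ (Eucl n)) : Measure (USphere n) :=
  ((volume : Measure U).toSphere).map (sphereIncl U)

section Pair

variable {n k : ℕ} (E F : Flat n k)

/-- The distance `d(E,F) = inf {‖x - y‖ : x ∈ E, y ∈ F}`. -/
def flatDist : ℝ := ⨅ p : E.space × F.space, dist (p.1 : Eucl n) (p.2 : Eucl n)

open Classical in
/-- The pair `(x_E, x_F)` of points `x_E ∈ E`, `x_F ∈ F` with `‖x_E - x_F‖ = d(E,F)`. It is
unique if `E` and `F` are in general position. -/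
def perpFeet : Eucl n × Eucl n :=
  if h : ∃ p : Eucl n × Eucl n, p.1 ∈ E.space ∧ p.2 ∈ F.space ∧ dist p.1 p.2 = flatDist E F
  then h.choose else 0

/-- The midpoint `m(E,F)` of `E` and `F`. -/
def mid : Eucl n := midpoint ℝ (perpFeet E F).1 (perpFeet E F).2

/-- The linear subspace `φ(E,F)` parallel to the orthogonal segment of `E` and `F`. -/
def segDir : Submodule ℝ (Eucl n) := Submodule.span ℝ {(perpFeet E F).2 - (perpFeet E F).1}

/-- The contribution of the orthogonal segment of `E` and `F`:
`A × B × C ↦ 1{m(E,F) ∈ A, d(E,F) ∈ B} · ½ ℋ⁰(φ(E,F) ∩ C)`. -/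
def segMeasure : Measure (Eucl n × ℝ × USphere n) :=
  (2⁻¹ : ℝ≥0∞) • (Measure.count.restrict {u : USphere n | (u : Eucl n) ∈ segDir E F}).map
    (fun u => (mid E F, flatDist E F, u))

end Pair

/-! ### Processes of flats -/

/-- A `k`-flat process in `ℝⁿ` (a simple point process on `A(n,k)`): a random locally finite set
of `k`-flats, measurable for the `σ`-algebra generated by the counting maps. -/
structure FlatProc (Ω : Type*) [MeasurableSpace Ω] (n k : ℕ) where
  /-- the random set of flats -/
  flats : Ω → Set (Flat n k)
  locallyFinite : ∀ ω, ∀ K : Set (Eucl n), IsCompact K → {F ∈ flats ω | F.Hits K}.Finite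
  measurable_count : ∀ B : Set (Flat n k), MeasurableSet B →
    Measurable fun ω => ((flats ω ∩ B).encard : ℝ≥0∞)

namespace FlatProc

variable {Ω : Type*} [MeasurableSpace Ω] {n k : ℕ}

/-- The counting measure on the flats of the process. -/
def pointMeasure (X : FlatProc Ω n k) (ω : Ω) : Measure (Flat n k) :=
  Measure.sum fun F : X.flats ω => Measure.dirac (F : Flat n k)

/-- The intensity measure `Θ(B) = 𝔼 X(B)`. -/
def intensityMeasure (X : FlatProc Ω n k) (P : Measure Ω) : Measure (Flat n k) :=
  P.bind X.pointMeasure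

theorem pointMeasure_apply (X : FlatProc Ω n k) (ω : Ω) {B : Set (Flat n k)}
    (hB : MeasurableSet B) : X.pointMeasure ω B = ((X.flats ω ∩ B).encard : ℝ≥0∞) := by
  classical
  rw [pointMeasure, Measure.sum_apply _ hB]
  simp only [Measure.dirac_apply' _ hB]
  rw [tsum_subtype (X.flats ω) (fun F => B.indicator (1 : Flat n k → ℝ≥0∞) F),
    ← ENNReal.tsum_set_one, ← tsum_subtype]
  rw [tsum_subtype (X.flats ω ∩ B) (fun _ => (1 : ℝ≥0∞)), tsum_subtype]
  congr 1
  funext F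
  by_cases h1 : F ∈ X.flats ω <;> by_cases h2 : F ∈ B <;> simp [Set.indicator, h1, h2]

theorem measurable_pointMeasure (X : FlatProc Ω n k) : Measurable X.pointMeasure := by
  refine Measure.measurable_of_measurable_coe _ fun B hB => ?_
  simp only [X.pointMeasure_apply _ hB]
  exact X.measurable_count B hB

theorem intensityMeasure_apply (X : FlatProc Ω n k) (P : Measure Ω) {B : Set (Flat n k)}
    (hB : MeasurableSet B) :
    X.intensityMeasure P B = ∫⁻ ω, ((X.flats ω ∩ B).encard : ℝ≥0∞) ∂P := by
  rw [intensityMeasure, Measure.bind_apply hB X.measurable_pointMeasure.aemeasurable]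
  simp only [X.pointMeasure_apply _ hB]

/-- The intensity measure is locally finite. -/
def LocallyFiniteIntensity (X : FlatProc Ω n k) (P : Measure Ω) : Prop :=
  ∀ K : Set (Eucl n), IsCompact K → X.intensityMeasure P {F | F.Hits K} < ∞

/-- Weak stationarity: the intensity measure is translation invariant. -/
def WeaklyStationary (X : FlatProc Ω n k) (P : Measure Ω) : Prop :=
  ∀ z : Eucl n, ∀ B : Set (Flat n k), MeasurableSet B →
    X.intensityMeasure P (Flat.translate z ⁻¹' B) = X.intensityMeasure P B

/-- The second factorial moment measure
`Θ⁽²⁾(S) = 𝔼 #{(E,F) ∈ X² : E ≠ F, (E,F) ∈ S}`, for measurable `S`. -/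
def factorialMoment (X : FlatProc Ω n k) (P : Measure Ω) (S : Set (Flat n k × Flat n k)) :
    ℝ≥0∞ :=
  ∫⁻ ω, (((X.flats ω).offDiag ∩ S).encard : ℝ≥0∞) ∂P

/-- The process is of type `(S₂)`: `Θ⁽²⁾ = Θ ⊗ Θ`. -/
def IsTypeS2 (X : FlatProc Ω n k) (P : Measure Ω) : Prop :=
  ∀ S : Set (Flat n k × Flat n k), MeasurableSet S →
    X.factorialMoment P S = ((X.intensityMeasure P).prod (X.intensityMeasure P)) S

/-- The intensity `γ = κ_{n-k}⁻¹ 𝔼 X({E : E ∩ Bⁿ ≠ ∅})`. -/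
def intensity (X : FlatProc Ω n k) (P : Measure Ω) : ℝ≥0∞ :=
  X.intensityMeasure P {F | F.Hits (Metric.closedBall 0 1)} / kappa (n - k)

/-- `Q` is a directional distribution of `X`: a probability measure on `G(n,k)` which, if the
intensity is non-zero, is the distribution of the directions of the flats hitting the unit ball.
(If the intensity is zero, then every probability measure on `G(n,k)` is allowed.) -/
def IsDirectionalDistribution (X : FlatProc Ω n k) (P : Measure Ω) (Q : Measure (Grass n k)) :
    Prop :=
  IsProbabilityMeasure Q ∧
    (X.intensity P ≠ 0 → ∀ D : Set (Grass n k), MeasurableSet D →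
      Q D = X.intensityMeasure P {F | F.Hits (Metric.closedBall 0 1) ∧ F.dir ∈ D} /
        X.intensityMeasure P {F | F.Hits (Metric.closedBall 0 1)})

/-! ### The proximity process -/

/-- The ordered pairs of distinct, disjoint flats of `X` in general position and at distance at
most `δ`. (For flats in general position, being disjoint means having positive distance.) -/
def closePairs (X : FlatProc Ω n k) (δ : ℝ) (ω : Ω) : Set (Flat n k × Flat n k) :=
  {p | p ∈ (X.flats ω).offDiag ∧ 0 < subspaceDet p.1.dir.space p.2.dir.space ∧
    0 < flatDist p.1 p.2 ∧ flatDist p.1 p.2 ≤ δ}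

/-- The proximity process `Φ` with distance threshold `δ`, as a random measure on the space of
triples (midpoint, length, unit direction vector), symmetric in the last component. The factor `½`
accounts for the two orderings of a pair of flats. -/
def segmentProc (X : FlatProc Ω n k) (δ : ℝ) (ω : Ω) :
    Measure (Eucl n × ℝ × USphere n) :=
  (2⁻¹ : ℝ≥0∞) • Measure.sum fun p : X.closePairs δ ω => segMeasure p.1.1 p.1.2

/-- The intensity measure `Λ = 𝔼 Φ` of the proximity process. -/
def proximityIntensityMeasure (X : FlatProc Ω n k) (P : Measure Ω) (δ : ℝ) :
    Measure (Eucl n × ℝ × USphere n) :=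
  P.bind (X.segmentProc δ)

/-- The proximity `π(X,δ)`: the intensity `κ_n⁻¹ Λ(Bⁿ × (0,∞) × Sⁿ⁻¹)` of the proximity process. -/
def proximity (X : FlatProc Ω n k) (P : Measure Ω) (δ : ℝ) : ℝ≥0∞ :=
  X.proximityIntensityMeasure P δ
    (Metric.closedBall (0 : Eucl n) 1 ×ˢ (Set.Ioi (0 : ℝ) ×ˢ (Set.univ : Set (USphere n)))) / kappa n

/-- The directional distribution
`ℛ(C) = Λ(Bⁿ × (0,∞) × C) / Λ(Bⁿ × (0,∞) × Sⁿ⁻¹)` of the proximity process. -/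
def proximityDirection (X : FlatProc Ω n k) (P : Measure Ω) (δ : ℝ) (C : Set (USphere n)) :
    ℝ≥0∞ :=
  X.proximityIntensityMeasure P δ
      (Metric.closedBall (0 : Eucl n) 1 ×ˢ (Set.Ioi (0 : ℝ) ×ˢ C)) /
    X.proximityIntensityMeasure P δ
      (Metric.closedBall (0 : Eucl n) 1 ×ˢ (Set.Ioi (0 : ℝ) ×ˢ (Set.univ : Set (USphere n))))

end FlatProc

/-- `∫∫ [L,M] Q(dM) Q(dL)`. -/
def meanDet {n k : ℕ} (Q : Measure (Grass n k)) : ℝ≥0∞ :=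
  ∫⁻ L, ∫⁻ M, ENNReal.ofReal (subspaceDet L.space M.space) ∂Q ∂Q

/-- `∫∫ [L,M] σ_{(L+M)ᗮ}(C ∩ (L+M)ᗮ) Q(dM) Q(dL)`. -/
def meanDetSph {n k : ℕ} (Q : Measure (Grass n k)) (C : Set (USphere n)) : ℝ≥0∞ :=
  ∫⁻ L, ∫⁻ M, ENNReal.ofReal (subspaceDet L.space M.space) *
    sphMeasure (L.space ⊔ M.space)ᗮ C ∂Q ∂Q

end FlatProximity

end

/-!
Write `P_L` for the orthogonal projection onto `L`, and `g x = exp (-π ‖x‖²)`, a function whose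
integral over every linear subspace is one. The flats of direction `L` are the sets `L + v`, and
an integral over `v ∈ Lᗮ` is the same as an integral over all `v ∈ ℝⁿ` with the additional factor
`g (P_L v)`. In this form the measure does not depend on the direction, and measurability in `L`
reduces to the joint measurability of the integrand.

*Disintegration of the intensity measure* (`kappa_mul_lintegral_eq`,
`FlatProc.lintegral_intensityMeasure`). Translation invariance of `Θ` and Tonelli's theorem give the
mass transport principle `lintegral_translate_swap`: in an integral of `h (E, E + v)` over `E` and
`v ⊥ L(E)`, the arguments of `h` may be exchanged. For `h (E, E') = f E · 1{E' hits the unit ball}`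
this says that `∫ f dΘ = γ ∫ Q(dL) ∫ f (L + v) g (P_L v) dv`.

*Pairs of flats with fixed directions* (`lintegral_pairFun`). Let `[L, M] > 0` and `N = (L + M)ᗮ`.
Writing `w = v + a + b + z` with `a ∈ L`, `b ∈ M`, `z ∈ N`, the common perpendicular of `L + v` and
`M + w` starts at `v + a` and is the vector `z`, while `dw = [L, M] da db dz` (`lintegral_sup`,
where the Jacobian is a Gram determinant). Integrating out `b` and then `a` leaves `[L, M]` times the
Lebesgue measure in the midpoint `m ∈ ℝⁿ` and in `z ∈ N`. Polar coordinates in `N`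
(`volume_polar`) separate the length from the direction.

*Measurability and the second moment.* Since `[L, M]² = det (1 - P_L P_M)`, and since the closest
points solve a linear system in terms of `P_L`, `P_M` and the feet of the flats (`explicitFeet`),
everything depends measurably on the pair of flats. The random counting measure is an s-finite
kernel, so that the value of the proximity process on a set is an integral against a measurable
family of product measures (`FlatProc.segmentProc_apply`). Pairs in general position consist of
distinct flats, hence the condition `(S₂)` turns its expectation into an integral with respect to
`Θ ⊗ Θ` (`FlatProc.lintegral_lintegral_prod_pointMeasure`).
-/

noncomputable section

namespace FlatProximity

variable {n k : ℕ}

/-! ### Topology and coordinates of the spaces of subspaces and flats -/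

@[ext] theorem Grass.ext {L M : Grass n k} (h : L.space = M.space) : L = M := by
  cases L; cases M; simp_all

@[ext] theorem Flat.ext {E F : Flat n k} (h : E.space = F.space) : E = F := by
  cases E; cases F; simp_all

/-- The flat `L + v`. -/
def Grass.flat (L : Grass n k) (v : Eucl n) : Flat n k where
  space := AffineSubspace.mk' v L.space
  nonempty := AffineSubspace.mk'_nonempty _ _
  finrank_eq := by rw [AffineSubspace.direction_mk']; exact L.finrank_eq

/-- The orthogonal projection onto `L`, as an operator on `ℝⁿ`. -/
def Grass.proj (L : Grass n k) : Eucl n →L[ℝ] Eucl n := L.space.starProjection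

theorem Grass.mem_flat {L : Grass n k} {v x : Eucl n} :
    x ∈ (L.flat v).space ↔ x - v ∈ L.space := by
  simp [Grass.flat, AffineSubspace.mem_mk']

@[simp] theorem Grass.dir_flat (L : Grass n k) (v : Eucl n) : (L.flat v).dir = L := by
  ext1; simp [Flat.dir, Grass.flat]

theorem Flat.foot_mem (F : Flat n k) : F.foot ∈ F.space :=
  EuclideanGeometry.orthogonalProjection_mem _

theorem Flat.foot_mem_orthogonal (F : Flat n k) : F.foot ∈ F.dir.spaceᗮ := by
  have := EuclideanGeometry.orthogonalProjection_mem_orthogonal F.space (0 : Eucl n)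
  rw [AffineSubspace.mem_mk', vsub_eq_sub, sub_zero] at this
  exact this

theorem Flat.flat_dir_of_mem {F : Flat n k} {x : Eucl n} (hx : x ∈ F.space) :
    F.dir.flat x = F := by
  ext1
  exact AffineSubspace.mk'_eq hx

@[simp] theorem Flat.flat_dir_foot (F : Flat n k) : F.dir.flat F.foot = F :=
  F.flat_dir_of_mem F.foot_mem

theorem Flat.mem_iff {F : Flat n k} {x : Eucl n} : x ∈ F.space ↔ x - F.foot ∈ F.dir.space := by
  rw [← Grass.mem_flat, F.flat_dir_foot]

@[simp] theorem Flat.proj_foot (F : Flat n k) : F.dir.proj F.foot = 0 :=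
  (Submodule.starProjection_apply_eq_zero_iff _).2 F.foot_mem_orthogonal

theorem Grass.foot_flat (L : Grass n k) (v : Eucl n) : (L.flat v).foot = v - L.proj v := by
  have h1 := Grass.mem_flat.1 (L.flat v).foot_mem
  have h2 := (L.flat v).foot_mem_orthogonal
  rw [Grass.dir_flat] at h2
  have h3 : L.proj v = v - (L.flat v).foot := by
    refine Submodule.eq_starProjection_of_mem_orthogonal ?_ ?_
    · rw [← neg_sub]; exact L.space.neg_mem h1
    · simpa using h2
  rw [h3]; abel

theorem Grass.translate_flat (L : Grass n k) (v z : Eucl n) :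
    (L.flat v).translate z = L.flat (v + z) := by
  have h1 : v + z ∈ ((L.flat v).translate z).space := by
    refine (AffineSubspace.mem_map).2 ⟨v, Grass.mem_flat.2 (by simp), ?_⟩
    simp [add_comm]
  have h2 : ((L.flat v).translate z).dir = L := by
    ext1
    have h : (AffineEquiv.constVAdd ℝ (Eucl n) z).toAffineMap.linear = LinearMap.id := by
      ext v; simp
    simp only [Flat.translate, Flat.dir, AffineSubspace.map_direction, h, Submodule.map_id]
    simp [Grass.flat]
  have := Flat.flat_dir_of_mem h1
  rw [h2] at this
  exact this.symm

theorem Flat.translate_eq (F : Flat n k) (z : Eucl n) :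
    F.translate z = F.dir.flat (F.foot + z) := by
  conv_lhs => rw [← F.flat_dir_foot]
  rw [Grass.translate_flat]

@[simp] theorem Flat.dir_translate (F : Flat n k) (z : Eucl n) : (F.translate z).dir = F.dir := by
  rw [F.translate_eq, Grass.dir_flat]

theorem Flat.translate_translate (F : Flat n k) (z w : Eucl n) :
    (F.translate z).translate w = F.translate (z + w) := by
  rw [F.translate_eq, Grass.translate_flat, F.translate_eq, add_assoc]

theorem Flat.translate_zero (F : Flat n k) : F.translate 0 = F := by
  rw [F.translate_eq, add_zero, F.flat_dir_foot]

theorem Flat.hits_closedBall {F : Flat n k} {r : ℝ} :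
    F.Hits (Metric.closedBall 0 r) ↔ ‖F.foot‖ ≤ r := by
  constructor
  · rintro ⟨x, hx, hxr⟩
    rw [mem_closedBall_zero_iff] at hxr
    have h1 : x - F.foot ∈ F.dir.space := Flat.mem_iff.1 hx
    have h2 : inner ℝ (x - F.foot) F.foot = 0 := F.foot_mem_orthogonal _ h1
    have h3 := norm_add_sq_eq_norm_sq_add_norm_sq_of_inner_eq_zero _ _ h2
    rw [sub_add_cancel] at h3
    nlinarith [norm_nonneg x, norm_nonneg F.foot, mul_self_nonneg ‖x - F.foot‖]
  · intro h
    exact ⟨F.foot, F.foot_mem, mem_closedBall_zero_iff.2 h⟩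

instance : SecondCountableTopology (Grass n k) :=
  TopologicalSpace.secondCountableTopology_induced _ _ _

instance : SecondCountableTopology (Flat n k) :=
  TopologicalSpace.secondCountableTopology_induced _ _ _

theorem continuous_proj : Continuous (Grass.proj (n := n) (k := k)) := continuous_induced_dom

theorem continuous_dir : Continuous (Flat.dir (n := n) (k := k)) :=
  continuous_fst.comp (continuous_induced_dom (f := fun F : Flat n k => (F.dir, F.foot)))

theorem continuous_foot : Continuous (Flat.foot (n := n) (k := k)) :=
  continuous_snd.comp (continuous_induced_dom (f := fun F : Flat n k => (F.dir, F.foot)))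

theorem continuous_flat : Continuous fun p : Grass n k × Eucl n => p.1.flat p.2 := by
  refine continuous_induced_rng.2 ?_
  simp only [Function.comp_def, Grass.dir_flat, Grass.foot_flat]
  refine continuous_fst.prodMk (continuous_snd.sub ?_)
  exact (continuous_proj.comp continuous_fst).clm_apply continuous_snd

theorem measurable_dir : Measurable (Flat.dir (n := n) (k := k)) := continuous_dir.measurable

theorem measurable_foot : Measurable (Flat.foot (n := n) (k := k)) := continuous_foot.measurable

@[fun_prop]
theorem _root_.Measurable.grassFlat {α : Type*} [MeasurableSpace α] {f : α → Grass n k}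
    {g : α → Eucl n} (hf : Measurable f) (hg : Measurable g) :
    Measurable fun a => (f a).flat (g a) :=
  continuous_flat.measurable.comp (hf.prodMk hg)

theorem measurable_proj_apply :
    Measurable fun p : Grass n k × Eucl n => p.1.proj p.2 := by
  refine Continuous.measurable ?_
  exact (continuous_proj.comp continuous_fst).clm_apply continuous_snd

theorem _root_.Measurable.grassProj {α : Type*} [MeasurableSpace α] {f : α → Grass n k}
    {g : α → Eucl n} (hf : Measurable f) (hg : Measurable g) :
    Measurable fun a => (f a).proj (g a) := by
  have h := (measurable_proj_apply (n := n) (k := k)).comp (hf.prodMk hg)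
  exact h

@[fun_prop]
theorem _root_.Measurable.flatDir {α : Type*} [MeasurableSpace α] {f : α → Flat n k}
    (hf : Measurable f) : Measurable fun a => (f a).dir := measurable_dir.comp hf

@[fun_prop]
theorem _root_.Measurable.flatFoot {α : Type*} [MeasurableSpace α] {f : α → Flat n k}
    (hf : Measurable f) : Measurable fun a => (f a).foot := measurable_foot.comp hf

@[fun_prop]
theorem _root_.Measurable.flatTranslate {α : Type*} [MeasurableSpace α] {f : α → Flat n k}
    {g : α → Eucl n} (hf : Measurable f) (hg : Measurable g) :
    Measurable fun a => (f a).translate (g a) := by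
  simp only [Flat.translate_eq]
  fun_prop

theorem measurableSet_hits_closedBall (r : ℝ) :
    MeasurableSet {F : Flat n k | F.Hits (Metric.closedBall 0 r)} := by
  simp only [Flat.hits_closedBall]
  exact measurableSet_le measurable_foot.norm measurable_const

/-! ### Linear changes of variables -/

theorem lintegral_repr_symm {H ι : Type*} [NormedAddCommGroup H]
    [InnerProductSpace ℝ H] [FiniteDimensional ℝ H] [MeasurableSpace H] [BorelSpace H]
    [Fintype ι] (e : OrthonormalBasis ι ℝ H) (f : H → ℝ≥0∞) (hf : Measurable f) :
    ∫⁻ c : ι → ℝ, f (e.repr.symm (WithLp.toLp 2 c)) = ∫⁻ x, f x := by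
  have h := hf.comp e.measurePreserving_repr_symm.measurable
  rw [← e.measurePreserving_repr_symm.lintegral_comp hf]
  exact (PiLp.volume_preserving_toLp ι).lintegral_comp h

theorem lintegral_orthonormalBasis {H ι : Type*} [NormedAddCommGroup H]
    [InnerProductSpace ℝ H] [FiniteDimensional ℝ H] [MeasurableSpace H] [BorelSpace H]
    [Fintype ι] (e : OrthonormalBasis ι ℝ H) (f : H → ℝ≥0∞) (hf : Measurable f) :
    ∫⁻ c : ι → ℝ, f (∑ i, c i • e i) = ∫⁻ x, f x := by
  rw [← lintegral_repr_symm e f hf]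
  simp [← e.sum_repr_symm]

theorem lintegral_eq_sqrt_det_gram_mul {H ι : Type*} [NormedAddCommGroup H]
    [InnerProductSpace ℝ H] [FiniteDimensional ℝ H] [MeasurableSpace H] [BorelSpace H]
    [Fintype ι] [DecidableEq ι] (hι : Fintype.card ι = Module.finrank ℝ H) (v : ι → H)
    (hv : (Matrix.gram ℝ v).det ≠ 0) (f : H → ℝ≥0∞) (hf : Measurable f) :
    ∫⁻ x, f x = ENNReal.ofReal (Real.sqrt (Matrix.gram ℝ v).det) *
      ∫⁻ c : ι → ℝ, f (∑ i, c i • v i) := by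
  let e : OrthonormalBasis ι ℝ H :=
    (stdOrthonormalBasis ℝ H).reindex (Fintype.equivOfCardEq (by simp [hι]))
  let A : Matrix ι ι ℝ := Matrix.of fun i j => e.repr (v j) i
  have hA : (Matrix.gram ℝ v).det = A.det ^ 2 := by
    rw [Matrix.gram_eq_conjTranspose_mul e v, Matrix.det_mul, Matrix.det_conjTranspose, sq]
    rfl
  have hA0 : A.det ≠ 0 := by
    intro h; rw [hA, h] at hv; simp at hv
  have hpt : ∀ c : ι → ℝ, ∑ i, c i • v i = e.repr.symm (WithLp.toLp 2 (Matrix.toLin' A c)) := by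
    intro c
    apply e.repr.injective
    ext i
    simp [A, Matrix.mulVec, dotProduct, mul_comm]
  have h1 := lintegral_repr_symm e f hf
  have h2 := Real.map_matrix_volume_pi_eq_smul_volume_pi hA0
  have hm : Measurable fun c : ι → ℝ => f (e.repr.symm (WithLp.toLp 2 c)) :=
    hf.comp (e.repr.symm.continuous.measurable.comp
      (PiLp.volume_preserving_toLp ι).measurable)
  have h3 : ∫⁻ c : ι → ℝ, f (∑ i, c i • v i) =
      ENNReal.ofReal |A.det⁻¹| * ∫⁻ c : ι → ℝ, f (e.repr.symm (WithLp.toLp 2 c)) := by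
    simp_rw [hpt]
    rw [← lintegral_map (f := fun c : ι → ℝ => f (e.repr.symm (WithLp.toLp 2 c))) hm
      (LinearMap.continuous_of_finiteDimensional _).measurable, h2, lintegral_smul_measure,
      smul_eq_mul]
  rw [h3, ← h1, ← mul_assoc, hA, Real.sqrt_sq_eq_abs, ← ENNReal.ofReal_mul (abs_nonneg _),
    ← abs_mul, mul_inv_cancel₀ hA0]
  simp

/-- Vectors made up of the images of orthonormal bases of `U` and `V` under linear maps into a space
of dimension `dim U + dim V` define linear coordinates whose Jacobian is the volume of the
parallelepiped that they span. -/
theorem lintegral_eq_sqrt_det_gram_mul_lintegral_lintegral {H U V : Type*} [NormedAddCommGroup H]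
    [InnerProductSpace ℝ H] [FiniteDimensional ℝ H] [MeasurableSpace H] [BorelSpace H]
    [NormedAddCommGroup U] [InnerProductSpace ℝ U] [FiniteDimensional ℝ U]
    [MeasurableSpace U] [BorelSpace U]
    [NormedAddCommGroup V] [InnerProductSpace ℝ V] [FiniteDimensional ℝ V]
    [MeasurableSpace V] [BorelSpace V]
    {ι κ : Type*} [Fintype ι] [Fintype κ] [DecidableEq ι] [DecidableEq κ]
    (i : U →ₗ[ℝ] H) (j : V →ₗ[ℝ] H) (e : OrthonormalBasis ι ℝ U) (e' : OrthonormalBasis κ ℝ V)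
    (hdim : Module.finrank ℝ U + Module.finrank ℝ V = Module.finrank ℝ H)
    (hv : (Matrix.gram ℝ (Sum.elim (fun x => i (e x)) fun y => j (e' y))).det ≠ 0)
    (f : H → ℝ≥0∞) (hf : Measurable f) :
    ∫⁻ x, f x =
      ENNReal.ofReal (Real.sqrt
        (Matrix.gram ℝ (Sum.elim (fun x => i (e x)) fun y => j (e' y))).det) *
      ∫⁻ u : U, ∫⁻ v : V, f (i u + j v) := by
  have hi : Measurable i := (LinearMap.continuous_of_finiteDimensional i).measurable
  have hj : Measurable j := (LinearMap.continuous_of_finiteDimensional j).measurable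
  have hcard : Fintype.card (ι ⊕ κ) = Module.finrank ℝ H := by
    rw [Fintype.card_sum, ← Module.finrank_eq_card_basis e.toBasis,
      ← Module.finrank_eq_card_basis e'.toBasis, hdim]
  rw [lintegral_eq_sqrt_det_gram_mul hcard _ hv f hf]
  congr 1
  have hg : Measurable fun c : ι ⊕ κ → ℝ =>
      f (∑ x, c x • (Sum.elim (fun x => i (e x)) fun y => j (e' y)) x) := by
    refine hf.comp ?_
    fun_prop
  rw [← (volume_measurePreserving_sumPiEquivProdPi_symm (fun _ : ι ⊕ κ => ℝ)).lintegral_comp hg]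
  have hg2 := hg.comp
    (volume_measurePreserving_sumPiEquivProdPi_symm (fun _ : ι ⊕ κ => ℝ)).measurable
  rw [Measure.volume_eq_prod]
  refine (lintegral_prod _ hg2.aemeasurable).trans ?_
  simp only [Function.comp_def, MeasurableEquiv.coe_sumPiEquivProdPi_symm,
    Fintype.sum_sum_type, Sum.elim_inl, Sum.elim_inr, Equiv.sumPiEquivProdPi, Equiv.coe_fn_symm_mk]
  have h1 : ∀ x : H, ∫⁻ y : κ → ℝ, f (x + ∑ l, y l • j (e' l)) = ∫⁻ v : V, f (x + j v) := by
    intro x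
    rw [← lintegral_orthonormalBasis e' (fun v : V => f (x + j v)) (by fun_prop)]
    simp
  simp_rw [h1]
  rw [← lintegral_orthonormalBasis e (fun u : U => ∫⁻ v : V, f (i u + j v))]
  · simp
  · exact Measurable.lintegral_prod_right' (f := fun p : U × V => f (i p.1 + j p.2)) (by fun_prop)

/-- Fubini's theorem for the orthogonal decomposition `H = U ⊕ Uᗮ`. -/
theorem lintegral_eq_lintegral_orthogonal {H : Type*} [NormedAddCommGroup H]
    [InnerProductSpace ℝ H] [FiniteDimensional ℝ H] [MeasurableSpace H] [BorelSpace H]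
    (U : Submodule ℝ H) (f : H → ℝ≥0∞) (hf : Measurable f) :
    ∫⁻ x, f x = ∫⁻ u : U, ∫⁻ v : Uᗮ, f (u + v) := by
  have hgram : Matrix.gram ℝ (Sum.elim (fun i => (stdOrthonormalBasis ℝ U i : H))
      fun j => (stdOrthonormalBasis ℝ Uᗮ j : H)) = 1 := by
    rw [Matrix.gram_eq_one_iff_orthonormal, orthonormal_iff_ite]
    have h1 := orthonormal_iff_ite.1 (stdOrthonormalBasis ℝ U).orthonormal
    have h2 := orthonormal_iff_ite.1 (stdOrthonormalBasis ℝ Uᗮ).orthonormal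
    rintro (i | i) (j | j)
    · simpa using h1 i j
    · simpa using (stdOrthonormalBasis ℝ Uᗮ j).2 _ (stdOrthonormalBasis ℝ U i).2
    · simpa [real_inner_comm] using (stdOrthonormalBasis ℝ Uᗮ i).2 _ (stdOrthonormalBasis ℝ U j).2
    · simpa using h2 i j
  rw [lintegral_eq_sqrt_det_gram_mul_lintegral_lintegral U.subtype Uᗮ.subtype
    (stdOrthonormalBasis ℝ U) (stdOrthonormalBasis ℝ Uᗮ) U.finrank_add_finrank_orthogonal
    (by simp only [Submodule.subtype_apply, hgram]; simp) f hf]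
  simp only [Submodule.subtype_apply, hgram]
  simp

/-! ### The subspace determinant -/

/-- The square of the subspace determinant is `det (1 - P_L P_M)`, which depends continuously on
the orthogonal projections. -/
theorem subspaceDet_eq_sqrt_det (L M : Submodule ℝ (Eucl n)) :
    subspaceDet L M = Real.sqrt (LinearMap.det
      (1 - L.starProjection ∘L M.starProjection : Eucl n →L[ℝ] Eucl n).toLinearMap) := by
  set a := stdOrthonormalBasis ℝ L
  set b := stdOrthonormalBasis ℝ M
  let A : Matrix (Fin n) (Fin (Module.finrank ℝ L)) ℝ := Matrix.of fun i l => (a l : Eucl n) i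
  let B : Matrix (Fin n) (Fin (Module.finrank ℝ M)) ℝ := Matrix.of fun i l => (b l : Eucl n) i
  have hproj : ∀ (U : Submodule ℝ (Eucl n)),
      LinearMap.toMatrix (EuclideanSpace.basisFun (Fin n) ℝ).toBasis
        (EuclideanSpace.basisFun (Fin n) ℝ).toBasis U.starProjection.toLinearMap =
      (Matrix.of fun i l => (stdOrthonormalBasis ℝ U l : Eucl n) i) *
        (Matrix.of fun i l => (stdOrthonormalBasis ℝ U l : Eucl n) i).transpose := by
    intro U
    ext i j
    rw [LinearMap.toMatrix_apply]
    have := (stdOrthonormalBasis ℝ U).starProjection_eq_sum_rankOne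
    simp only [this, Matrix.mul_apply]
    simp [PiLp.inner_apply]
    exact Finset.sum_congr rfl fun x _ => mul_comm _ _
  have hgram : Matrix.gram ℝ (Sum.elim (fun i => (a i : Eucl n)) fun j => (b j : Eucl n)) =
      Matrix.fromBlocks 1 (A.transpose * B) (B.transpose * A) 1 := by
    have h1 := orthonormal_iff_ite.1 a.orthonormal
    have h2 := orthonormal_iff_ite.1 b.orthonormal
    ext (i | i) (j | j)
    · simpa [Matrix.one_apply] using h1 i j
    · simp only [Matrix.gram_apply, Sum.elim_inl, Sum.elim_inr, PiLp.inner_apply,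
        Matrix.fromBlocks_apply₁₂, Matrix.mul_apply]
      exact Finset.sum_congr rfl fun x _ => mul_comm _ _
    · simp only [Matrix.gram_apply, Sum.elim_inl, Sum.elim_inr, PiLp.inner_apply,
        Matrix.fromBlocks_apply₂₁, Matrix.mul_apply]
      exact Finset.sum_congr rfl fun x _ => mul_comm _ _
    · simpa [Matrix.one_apply] using h2 i j
  rw [subspaceDet, spannedVolume, hgram, Matrix.det_fromBlocks_one₁₁,
    ← LinearMap.det_toMatrix (EuclideanSpace.basisFun (Fin n) ℝ).toBasis]
  congr 1
  have h3 : LinearMap.toMatrix (EuclideanSpace.basisFun (Fin n) ℝ).toBasis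
        (EuclideanSpace.basisFun (Fin n) ℝ).toBasis
        (1 - L.starProjection ∘L M.starProjection : Eucl n →L[ℝ] Eucl n).toLinearMap =
      1 - A * A.transpose * (B * B.transpose) := by
    rw [ContinuousLinearMap.toLinearMap_sub, map_sub, ContinuousLinearMap.toLinearMap_comp,
      LinearMap.toMatrix_comp _ (EuclideanSpace.basisFun (Fin n) ℝ).toBasis, hproj L, hproj M]
    congr 1
    exact LinearMap.toMatrix_one _
  rw [h3]
  calc (1 - B.transpose * A * (A.transpose * B)).det
      = (1 - B.transpose * (A * A.transpose * B)).det := by simp only [Matrix.mul_assoc]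
    _ = (1 - A * A.transpose * (B * B.transpose)).det := by
      rw [Matrix.det_one_sub_mul_comm, Matrix.mul_assoc]

theorem disjoint_of_subspaceDet_pos {L M : Submodule ℝ (Eucl n)} (h : 0 < subspaceDet L M) :
    Disjoint L M := by
  rw [Submodule.disjoint_def]
  intro x hL hM
  rw [subspaceDet_eq_sqrt_det, Real.sqrt_pos] at h
  by_contra hx
  have : (1 - L.starProjection ∘L M.starProjection : Eucl n →L[ℝ] Eucl n).toLinearMap x = 0 := by
    simp [Submodule.starProjection_eq_self_iff.2 hL, Submodule.starProjection_eq_self_iff.2 hM]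
  exact h.ne' (LinearMap.det_eq_zero_iff_ker_ne_bot.2 ((Submodule.ne_bot_iff _).2 ⟨x, this, hx⟩))

/-- The map `L × M → L + M`, `(a, b) ↦ a + b` has Jacobian `[L, M]`. -/
theorem lintegral_sup {L M : Submodule ℝ (Eucl n)} (h : 0 < subspaceDet L M)
    (f : Eucl n → ℝ≥0∞) (hf : Measurable f) :
    ∫⁻ u : ↥(L ⊔ M), f u = ENNReal.ofReal (subspaceDet L M) *
      ∫⁻ a : L, ∫⁻ b : M, f (a + b) := by
  have hdim : Module.finrank ℝ L + Module.finrank ℝ M = Module.finrank ℝ ↥(L ⊔ M) := by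
    rw [← Submodule.finrank_sup_add_finrank_inf_eq, (disjoint_of_subspaceDet_pos h).eq_bot,
      finrank_bot, add_zero]
  let i : L →ₗ[ℝ] ↥(L ⊔ M) := Submodule.inclusion le_sup_left
  let j : M →ₗ[ℝ] ↥(L ⊔ M) := Submodule.inclusion le_sup_right
  have hgram : Matrix.gram ℝ (Sum.elim (fun x => i (stdOrthonormalBasis ℝ L x))
        fun y => j (stdOrthonormalBasis ℝ M y)) =
      Matrix.gram ℝ (Sum.elim (fun x => (stdOrthonormalBasis ℝ L x : Eucl n))
        fun y => (stdOrthonormalBasis ℝ M y : Eucl n)) := by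
    ext (x | x) (y | y) <;> rfl
  have hpos : (Matrix.gram ℝ (Sum.elim (fun x => (stdOrthonormalBasis ℝ L x : Eucl n))
        fun y => (stdOrthonormalBasis ℝ M y : Eucl n))).det ≠ 0 := (Real.sqrt_pos.1 h).ne'
  rw [lintegral_eq_sqrt_det_gram_mul_lintegral_lintegral i j _ _ hdim (by rwa [hgram])
    (fun u => f u) (by fun_prop), hgram]
  rfl

/-! ### The common perpendicular of two flats -/

theorem measurable_subspaceDet :
    Measurable fun p : Grass n k × Grass n k => subspaceDet p.1.space p.2.space := by
  simp only [subspaceDet_eq_sqrt_det]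
  refine Continuous.measurable ?_
  refine Real.continuous_sqrt.comp ?_
  have h1 : Continuous fun p : Grass n k × Grass n k =>
      (1 - p.1.proj ∘L p.2.proj : Eucl n →L[ℝ] Eucl n) :=
    continuous_const.sub ((continuous_proj.comp continuous_fst).clm_comp
      (continuous_proj.comp continuous_snd))
  exact ContinuousLinearMap.continuous_det.comp h1

/-- If a segment joining a point of `E` to a point of `F` is orthogonal to both flats, and the
directions of the flats are independent, then its endpoints are the only pair of closest points. -/
theorem perpFeet_eq_and_flatDist_eq {E F : Flat n k} (h : Disjoint E.dir.space F.dir.space)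
    {x y : Eucl n} (hx : x ∈ E.space) (hy : y ∈ F.space)
    (hxy : y - x ∈ (E.dir.space ⊔ F.dir.space)ᗮ) :
    perpFeet E F = (x, y) ∧ flatDist E F = ‖y - x‖ := by
  -- Any other pair of points differs from `(x, y)` by vectors of `L(E)` and `L(F)`, to which `y - x`
  -- is orthogonal, and Pythagoras applies.
  have key : ∀ x' ∈ E.space, ∀ y' ∈ F.space, dist x' y' * dist x' y' =
      ‖y - x‖ * ‖y - x‖ + ‖(y' - y) - (x' - x)‖ * ‖(y' - y) - (x' - x)‖ := by
    intro x' hx' y' hy'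
    have hu : x' - x ∈ E.dir.space := AffineSubspace.vsub_mem_direction hx' hx
    have hv : y' - y ∈ F.dir.space := AffineSubspace.vsub_mem_direction hy' hy
    have hmem : (y' - y) - (x' - x) ∈ E.dir.space ⊔ F.dir.space :=
      Submodule.sub_mem _ (Submodule.mem_sup_right hv) (Submodule.mem_sup_left hu)
    have := norm_add_sq_eq_norm_sq_add_norm_sq_of_inner_eq_zero _ _
      ((Submodule.mem_orthogonal' _ _).1 hxy _ hmem)
    rw [← this, dist_comm, dist_eq_norm]
    congr 2 <;> abel
  have hle : ∀ x' ∈ E.space, ∀ y' ∈ F.space, ‖y - x‖ ≤ dist x' y' := by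
    intro x' hx' y' hy'
    have := key x' hx' y' hy'
    nlinarith [norm_nonneg (y - x), dist_nonneg (x := x') (y := y'),
      mul_self_nonneg ‖(y' - y) - (x' - x)‖]
  have hdist : flatDist E F = ‖y - x‖ := by
    refine le_antisymm ?_ ?_
    · refine (ciInf_le ⟨0, ?_⟩ (⟨⟨x, hx⟩, ⟨y, hy⟩⟩ : E.space × F.space)).trans ?_
      · rintro _ ⟨p, rfl⟩
        exact dist_nonneg
      · rw [dist_comm, dist_eq_norm]
    · exact le_ciInf fun p => hle _ p.1.2 _ p.2.2
  refine ⟨?_, hdist⟩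
  have hex : ∃ p : Eucl n × Eucl n, p.1 ∈ E.space ∧ p.2 ∈ F.space ∧
      dist p.1 p.2 = flatDist E F :=
    ⟨(x, y), hx, hy, by rw [hdist, dist_comm, dist_eq_norm]⟩
  rw [perpFeet, dif_pos hex]
  obtain ⟨h1, h2, h3⟩ := hex.choose_spec
  set p := hex.choose
  have h4 := key _ h1 _ h2
  rw [h3, hdist] at h4
  have h5 : (p.2 - y) - (p.1 - x) = 0 := by
    rw [← norm_eq_zero]
    nlinarith
  have hu : p.1 - x ∈ E.dir.space := AffineSubspace.vsub_mem_direction h1 hx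
  have hv : p.2 - y ∈ F.dir.space := AffineSubspace.vsub_mem_direction h2 hy
  have h6 : p.1 - x = 0 :=
    (Submodule.disjoint_def.1 h) _ hu (by rw [← sub_eq_zero.1 h5]; exact hv)
  rw [h6, sub_zero, sub_eq_zero] at h5
  rw [sub_eq_zero] at h6
  exact Prod.ext h6 h5

/-- For flats `E`, `F` in general position, the vector `a ∈ L(E)` from the foot of `E` to the point
of `E` closest to `F`. It solves `(1 - P_L P_M) a = P_L (1 - P_M) w`, where `L = L(E)`, `M = L(F)`
and `w` is the difference of the feet. -/
def offset (E F : Flat n k) : Eucl n :=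
  Ring.inverse (1 - E.dir.proj * F.dir.proj : Eucl n →L[ℝ] Eucl n)
    (E.dir.proj ((F.foot - E.foot) - F.dir.proj (F.foot - E.foot)))

/-- The pair of closest points of two flats in general position, in terms of their directions and
feet. -/
def explicitFeet (E F : Flat n k) : Eucl n × Eucl n :=
  (E.foot + offset E F, F.foot + F.dir.proj (offset E F - (F.foot - E.foot)))

/-- The vector `offset E F` lies in `L(E)` because it solves its defining equation, whose operator
`1 - P_L P_M` is invertible for flats in general position. -/
theorem explicitFeet_spec {E F : Flat n k} (h : 0 < subspaceDet E.dir.space F.dir.space) :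
    (explicitFeet E F).1 ∈ E.space ∧ (explicitFeet E F).2 ∈ F.space ∧
      (explicitFeet E F).2 - (explicitFeet E F).1 ∈ (E.dir.space ⊔ F.dir.space)ᗮ := by
  set L := E.dir with hL
  set M := F.dir with hM
  set w := F.foot - E.foot with hw
  set a := offset E F with ha
  have hunit : IsUnit (1 - L.proj * M.proj : Eucl n →L[ℝ] Eucl n) := by
    rw [subspaceDet_eq_sqrt_det, Real.sqrt_pos] at h
    rw [ContinuousLinearMap.isUnit_iff_isUnit_toLinearMap, LinearMap.isUnit_iff_isUnit_det]
    exact isUnit_iff_ne_zero.2 h.ne'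
  have hsol : a - L.proj (M.proj a) = L.proj (w - M.proj w) := by
    have := congrArg (fun T : Eucl n →L[ℝ] Eucl n => T (L.proj (w - M.proj w)))
      (Ring.mul_inverse_cancel _ hunit)
    exact this
  have haL : a ∈ L.space := by
    rw [sub_eq_iff_eq_add] at hsol
    rw [hsol]
    exact L.space.add_mem (Submodule.starProjection_apply_mem _ _)
      (Submodule.starProjection_apply_mem _ _)
  have hbM : M.proj (a - w) ∈ M.space := Submodule.starProjection_apply_mem _ _
  refine ⟨?_, ?_, ?_⟩
  · rw [Flat.mem_iff]
    change _ + _ - _ ∈ _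
    rw [add_sub_cancel_left]
    exact haL
  · rw [Flat.mem_iff]
    change _ + _ - _ ∈ _
    rw [add_sub_cancel_left]
    exact hbM
  · have hz : (explicitFeet E F).2 - (explicitFeet E F).1 = w + M.proj (a - w) - a := by
      simp only [explicitFeet, hw, ha]
      abel
    have hPa : L.proj a = a := Submodule.starProjection_eq_self_iff.2 haL
    have hPP : M.proj (M.proj (a - w)) = M.proj (a - w) :=
      Submodule.starProjection_eq_self_iff.2 hbM
    rw [hz, ← Submodule.inf_orthogonal, Submodule.mem_inf,
      ← Submodule.starProjection_apply_eq_zero_iff, ← Submodule.starProjection_apply_eq_zero_iff]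
    change L.proj _ = 0 ∧ M.proj _ = 0
    constructor
    · have h2 : L.proj (w + M.proj (a - w) - a) =
          L.proj (w - M.proj w) - (L.proj a - L.proj (M.proj a)) := by
        simp only [map_add, map_sub]; abel
      rw [h2, hPa, hsol, sub_self]
    · have h2 : M.proj (w + M.proj (a - w) - a) =
          M.proj (M.proj (a - w)) - M.proj (a - w) := by
        simp only [map_add, map_sub]; abel
      rw [h2, hPP, sub_self]

theorem perpFeet_eq_explicitFeet {E F : Flat n k}
    (h : 0 < subspaceDet E.dir.space F.dir.space) : perpFeet E F = explicitFeet E F := by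
  obtain ⟨h1, h2, h3⟩ := explicitFeet_spec h
  exact (perpFeet_eq_and_flatDist_eq (disjoint_of_subspaceDet_pos h) h1 h2 h3).1

theorem flatDist_eq_norm_explicitFeet {E F : Flat n k}
    (h : 0 < subspaceDet E.dir.space F.dir.space) :
    flatDist E F = ‖(explicitFeet E F).2 - (explicitFeet E F).1‖ := by
  obtain ⟨h1, h2, h3⟩ := explicitFeet_spec h
  exact (perpFeet_eq_and_flatDist_eq (disjoint_of_subspaceDet_pos h) h1 h2 h3).2

theorem measurable_ringInverse {R : Type*} [NormedRing R] [HasSummableGeomSeries R]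
    [MeasurableSpace R] [BorelSpace R] : Measurable (Ring.inverse : R → R) := by
  classical
  have h : ContinuousOn (Ring.inverse : R → R) {x | IsUnit x} := by
    rintro x ⟨u, rfl⟩
    exact (NormedRing.inverse_continuousAt u).continuousWithinAt
  have h2 : (Ring.inverse : R → R) = {x | IsUnit x}.piecewise Ring.inverse 0 := by
    ext x
    by_cases hx : IsUnit x
    · simp [Set.piecewise, hx]
    · simp [Set.piecewise, hx, Ring.inverse_non_unit]
  rw [h2]
  exact h.measurable_piecewise continuous_zero.continuousOn Units.isOpen.measurableSet

theorem measurable_offset : Measurable fun p : Flat n k × Flat n k => offset p.1 p.2 := by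
  have hcont : Continuous fun p : Flat n k × Flat n k =>
      (1 - p.1.dir.proj * p.2.dir.proj : Eucl n →L[ℝ] Eucl n) :=
    continuous_const.sub
      ((continuous_proj.comp (continuous_dir.comp continuous_fst)).mul
      (continuous_proj.comp (continuous_dir.comp continuous_snd)))
  have hinv : Measurable fun p : Flat n k × Flat n k =>
      Ring.inverse (1 - p.1.dir.proj * p.2.dir.proj : Eucl n →L[ℝ] Eucl n) :=
    measurable_ringInverse.comp hcont.measurable
  have hw : Measurable fun p : Flat n k × Flat n k => p.2.foot - p.1.foot := by fun_prop
  have hv : Measurable fun p : Flat n k × Flat n k => p.1.dir.proj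
      ((p.2.foot - p.1.foot) - p.2.dir.proj (p.2.foot - p.1.foot)) :=
    Measurable.grassProj (by fun_prop) (hw.sub (Measurable.grassProj (by fun_prop) hw))
  have happ : Measurable fun q : (Eucl n →L[ℝ] Eucl n) × Eucl n => q.1 q.2 :=
    (continuous_fst.clm_apply continuous_snd).measurable
  exact happ.comp (hinv.prodMk hv)

theorem measurable_explicitFeet :
    Measurable fun p : Flat n k × Flat n k => explicitFeet p.1 p.2 := by
  have ho := measurable_offset (n := n) (k := k)
  have h : Measurable fun p : Flat n k × Flat n k =>
      p.2.dir.proj (offset p.1 p.2 - (p.2.foot - p.1.foot)) :=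
    Measurable.grassProj (by fun_prop) (by fun_prop)
  exact Measurable.prodMk (by fun_prop) (Measurable.add (by fun_prop) h)

/-! ### Disintegration of a translation invariant measure on the space of flats -/

/-- The Gaussian density `exp (-π ‖x‖²)`. Its integral is one in every dimension, so that it serves
as a probability density on all subspaces of `ℝⁿ` simultaneously. -/
def gauss {H : Type*} [NormedAddCommGroup H] (x : H) : ℝ≥0∞ :=
  ENNReal.ofReal (Real.exp (-Real.pi * ‖x‖ ^ 2))

@[fun_prop]
theorem measurable_gauss {H : Type*} [NormedAddCommGroup H] [MeasurableSpace H] [BorelSpace H] :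
    Measurable (gauss : H → ℝ≥0∞) := by
  unfold gauss
  fun_prop

@[simp] theorem gauss_neg {H : Type*} [NormedAddCommGroup H] (x : H) : gauss (-x) = gauss x := by
  simp [gauss]

theorem lintegral_gauss (H : Type*) [NormedAddCommGroup H] [InnerProductSpace ℝ H]
    [FiniteDimensional ℝ H] [MeasurableSpace H] [BorelSpace H] : ∫⁻ x : H, gauss x = 1 := by
  have h := GaussianFourier.integral_rexp_neg_mul_sq_norm (V := H) Real.pi_pos
  rw [div_self Real.pi_ne_zero, Real.one_rpow] at h
  unfold gauss
  rw [← ofReal_integral_eq_lintegral_ofReal (integrable_of_integral_eq_one h)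
    (Filter.Eventually.of_forall fun x => (Real.exp_pos _).le), h, ENNReal.ofReal_one]

theorem volume_closedBall_eq_kappa {H : Type*} [NormedAddCommGroup H] [InnerProductSpace ℝ H]
    [FiniteDimensional ℝ H] [MeasurableSpace H] [BorelSpace H] {m : ℕ}
    (h : Module.finrank ℝ H = m) : volume (Metric.closedBall (0 : H) 1) = kappa m := by
  subst h
  rw [kappa, ← (stdOrthonormalBasis ℝ H).measurePreserving_repr.measure_preimage
    Metric.isClosed_closedBall.measurableSet.nullMeasurableSet]
  congr 1
  ext x
  simp

theorem kappa_ne_zero (m : ℕ) : kappa m ≠ 0 :=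
  (Metric.measure_closedBall_pos volume _ one_pos).ne'

theorem kappa_ne_top (m : ℕ) : kappa m ≠ ∞ := measure_closedBall_lt_top.ne

theorem Grass.proj_add {L : Grass n k} (u : L.space) (y : L.spaceᗮ) :
    L.proj ((u : Eucl n) + y) = u :=
  Submodule.eq_starProjection_of_mem_orthogonal' u.2 y.2 rfl

theorem Grass.finrank_orthogonal (L : Grass n k) : Module.finrank ℝ L.spaceᗮ = n - k := by
  have := L.space.finrank_add_finrank_orthogonal
  rw [L.finrank_eq, finrank_euclideanSpace_fin] at this
  omega

theorem measurable_uncurry_flat_gauss {f : Flat n k → ℝ≥0∞} (hf : Measurable f) :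
    Measurable fun p : Grass n k × Eucl n => f (p.1.flat p.2) * gauss (p.1.proj p.2) :=
  Measurable.mul (by fun_prop) (measurable_gauss.comp measurable_proj_apply)

theorem Grass.measurable_flat_gauss (L : Grass n k) {f : Flat n k → ℝ≥0∞} (hf : Measurable f) :
    Measurable fun v : Eucl n => f (L.flat v) * gauss (L.proj v) := by
  have h : Measurable fun v : Eucl n => L.flat v := by fun_prop
  have h2 : Measurable fun v : Eucl n => L.proj v := L.proj.continuous.measurable
  exact (hf.comp h).mul (measurable_gauss.comp h2)

/-- The parallel translates of `L` that hit the unit ball have measure `κ_{n-k}`. -/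
theorem lintegral_hits_mul_gauss (L : Grass n k) :
    ∫⁻ v, {F : Flat n k | F.Hits (Metric.closedBall 0 1)}.indicator 1 (L.flat v) *
      gauss (L.proj v) = kappa (n - k) := by
  have hm : Measurable fun v =>
      {F : Flat n k | F.Hits (Metric.closedBall 0 1)}.indicator (1 : Flat n k → ℝ≥0∞) (L.flat v) *
      gauss (L.proj v) :=
    L.measurable_flat_gauss (measurable_one.indicator (measurableSet_hits_closedBall 1))
  rw [lintegral_eq_lintegral_orthogonal L.space _ hm]
  have h1 : ∀ (u : L.space) (y : L.spaceᗮ),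
      {F : Flat n k | F.Hits (Metric.closedBall 0 1)}.indicator (1 : Flat n k → ℝ≥0∞)
        (L.flat (u + y)) * gauss (L.proj ((u : Eucl n) + y)) =
      gauss u * (Metric.closedBall (0 : L.spaceᗮ) 1).indicator 1 y := by
    intro u y
    rw [L.proj_add, mul_comm]
    congr 1
    · simp only [Set.indicator, Set.mem_ofPred_eq, Flat.hits_closedBall, L.foot_flat, L.proj_add,
        add_sub_cancel_left, mem_closedBall_zero_iff, Submodule.coe_norm, Pi.one_apply]
  simp_rw [h1]
  have h2 : ∀ u : L.space, ∫⁻ y : L.spaceᗮ, gauss u *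
      (Metric.closedBall (0 : L.spaceᗮ) 1).indicator 1 y = gauss u * kappa (n - k) := by
    intro u
    have hmeas : MeasurableSet (Metric.closedBall (0 : L.spaceᗮ) 1) :=
      Metric.isClosed_closedBall.measurableSet
    rw [lintegral_const_mul _ (measurable_one.indicator hmeas),
      lintegral_indicator_one hmeas, volume_closedBall_eq_kappa L.finrank_orthogonal]
  simp_rw [h2]
  rw [lintegral_mul_const _ measurable_gauss, lintegral_gauss, one_mul]

/-- Mass transport: for a translation invariant measure on flats, the roles of a flat and its
translate can be exchanged. The Gaussian factor turns the integral over all of `ℝⁿ` into an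
integral over the translations orthogonal to the flat. -/
theorem lintegral_translate_swap {Θ : Measure (Flat n k)} [SFinite Θ]
    (hinv : ∀ z : Eucl n, ∀ B : Set (Flat n k), MeasurableSet B →
      Θ (Flat.translate z ⁻¹' B) = Θ B)
    {h : Flat n k × Flat n k → ℝ≥0∞} (hh : Measurable h) :
    ∫⁻ E, (∫⁻ v, h (E, E.translate v) * gauss (E.dir.proj v)) ∂Θ =
      ∫⁻ E, (∫⁻ v, h (E.translate v, E) * gauss (E.dir.proj v)) ∂Θ := by
  have hpres : ∀ z : Eucl n, MeasurePreserving (Flat.translate z) Θ Θ := fun z => by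
    have hm : Measurable (Flat.translate z : Flat n k → Flat n k) :=
      Measurable.flatTranslate (f := fun F => F) measurable_id measurable_const
    exact ⟨hm, Measure.ext fun B hB => by rw [Measure.map_apply hm hB, hinv z B hB]⟩
  have hg : Measurable fun p : Flat n k × Eucl n => gauss (p.1.dir.proj p.2) :=
    measurable_gauss.comp (Measurable.grassProj (f := fun p : Flat n k × Eucl n => p.1.dir)
      (g := Prod.snd) (by fun_prop) measurable_snd)
  have ht : Measurable fun p : Flat n k × Eucl n => p.1.translate p.2 := by fun_prop
  have hm1 : Measurable fun p : Flat n k × Eucl n =>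
      h (p.1, p.1.translate p.2) * gauss (p.1.dir.proj p.2) :=
    (hh.comp (measurable_fst.prodMk ht)).mul hg
  have hm2 : Measurable fun p : Flat n k × Eucl n =>
      h (p.1.translate p.2, p.1) * gauss (p.1.dir.proj p.2) :=
    (hh.comp (ht.prodMk measurable_fst)).mul hg
  refine (lintegral_lintegral_swap hm1.aemeasurable).trans ?_
  refine Eq.trans ?_ (lintegral_lintegral_swap hm2.aemeasurable).symm
  refine (lintegral_neg_eq_self _).symm.trans ?_
  refine lintegral_congr fun v => ?_
  have hm3 : Measurable fun E : Flat n k =>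
      h (E, E.translate (-v)) * gauss (E.dir.proj (-v)) := hm1.comp measurable_prodMk_right
  rw [← (hpres v).lintegral_comp hm3]
  refine lintegral_congr fun E => ?_
  rw [Flat.translate_translate, add_neg_cancel, Flat.translate_zero, Flat.dir_translate, map_neg,
    gauss_neg]

theorem lintegral_translate_gauss {f : Flat n k → ℝ≥0∞} (E : Flat n k) :
    ∫⁻ v, f (E.translate v) * gauss (E.dir.proj v) =
      ∫⁻ v, f (E.dir.flat v) * gauss (E.dir.proj v) := by
  rw [← lintegral_add_left_eq_self (fun v => f (E.dir.flat v) * gauss (E.dir.proj v)) E.foot]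
  simp only [Flat.translate_eq, map_add, Flat.proj_foot, zero_add]

/-- A translation invariant measure on the flats is, up to normalization, the distribution of
`L + v` with `L` distributed according to the directional distribution and `v` according to the
Lebesgue measure on `Lᗮ`. -/
theorem kappa_mul_lintegral_eq {Θ : Measure (Flat n k)} [SFinite Θ]
    (hinv : ∀ z : Eucl n, ∀ B : Set (Flat n k), MeasurableSet B →
      Θ (Flat.translate z ⁻¹' B) = Θ B) {f : Flat n k → ℝ≥0∞} (hf : Measurable f) :
    kappa (n - k) * ∫⁻ E, f E ∂Θ =
      ∫⁻ L, (∫⁻ v, f (L.flat v) * gauss (L.proj v))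
        ∂((Θ.restrict {F | F.Hits (Metric.closedBall 0 1)}).map Flat.dir) := by
  set H : Set (Flat n k) := {F | F.Hits (Metric.closedBall 0 1)}
  have hH : MeasurableSet H := measurableSet_hits_closedBall 1
  have hψ : Measurable (H.indicator (1 : Flat n k → ℝ≥0∞)) := measurable_one.indicator hH
  have key := lintegral_translate_swap hinv (h := fun p => f p.1 * H.indicator 1 p.2)
    ((hf.comp measurable_fst).mul (hψ.comp measurable_snd))
  have hleft : ∀ E : Flat n k, ∫⁻ v, f E * H.indicator 1 (E.translate v) * gauss (E.dir.proj v) =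
      f E * kappa (n - k) := by
    intro E
    have h1 : Measurable fun v => H.indicator 1 (E.translate v) * gauss (E.dir.proj v) := by
      refine Measurable.mul (hψ.comp (by fun_prop)) (measurable_gauss.comp ?_)
      exact E.dir.proj.continuous.measurable
    simp_rw [mul_assoc]
    rw [lintegral_const_mul _ h1, lintegral_translate_gauss (f := H.indicator 1),
      lintegral_hits_mul_gauss]
  have hright : ∀ E : Flat n k, ∫⁻ v, f (E.translate v) * H.indicator 1 E * gauss (E.dir.proj v) =
      H.indicator (fun E => ∫⁻ v, f (E.dir.flat v) * gauss (E.dir.proj v)) E := by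
    intro E
    by_cases hE : E ∈ H
    · simp [Set.indicator_of_mem hE, lintegral_translate_gauss]
    · simp [Set.indicator_of_notMem hE]
  have hm : Measurable fun L : Grass n k => ∫⁻ v, f (L.flat v) * gauss (L.proj v) :=
    (measurable_uncurry_flat_gauss hf).lintegral_prod_right'
  simp only [hleft, hright] at key
  rw [lintegral_mul_const _ hf, lintegral_indicator hH] at key
  rw [lintegral_map hm measurable_dir, mul_comm, key]

/-! ### Integration over pairs of flats with given directions -/

open Classical in
/-- A function of the midpoint and of the difference vector of the closest points of two flats in
general position, extended by zero to all pairs of flats. -/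
def pairFun (G : Eucl n × Eucl n → ℝ≥0∞) (p : Flat n k × Flat n k) : ℝ≥0∞ :=
  if 0 < subspaceDet p.1.dir.space p.2.dir.space then
    G (midpoint ℝ (explicitFeet p.1 p.2).1 (explicitFeet p.1 p.2).2,
      (explicitFeet p.1 p.2).2 - (explicitFeet p.1 p.2).1)
  else 0

theorem measurableSet_subspaceDet_pos :
    MeasurableSet {p : Flat n k × Flat n k | 0 < subspaceDet p.1.dir.space p.2.dir.space} := by
  have h : Measurable fun p : Flat n k × Flat n k => (p.1.dir, p.2.dir) := by fun_prop
  have h2 := (measurable_subspaceDet (n := n) (k := k)).comp h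
  exact measurableSet_lt measurable_const h2

theorem measurable_pairFun {G : Eucl n × Eucl n → ℝ≥0∞} (hG : Measurable G) :
    Measurable (pairFun G : Flat n k × Flat n k → ℝ≥0∞) := by
  refine Measurable.ite measurableSet_subspaceDet_pos ?_ measurable_const
  have h1 := (measurable_explicitFeet (n := n) (k := k)).fst
  have h2 := (measurable_explicitFeet (n := n) (k := k)).snd
  refine hG.comp (Measurable.prodMk ?_ (h2.sub h1))
  simp only [midpoint_eq_smul_add]
  exact (h1.add h2).const_smul (⅟2 : ℝ)

theorem pairFun_flat_flat {G : Eucl n × Eucl n → ℝ≥0∞} {L M : Grass n k}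
    (h : 0 < subspaceDet L.space M.space) (v : Eucl n) {a b z : Eucl n} (ha : a ∈ L.space)
    (hb : b ∈ M.space) (hz : z ∈ (L.space ⊔ M.space)ᗮ) :
    pairFun G (L.flat v, M.flat (v + (a + b + z))) = G (v + a + (2⁻¹ : ℝ) • z, z) := by
  have hdet : 0 < subspaceDet (L.flat v).dir.space (M.flat (v + (a + b + z))).dir.space := by
    simpa using h
  have hx : v + a ∈ (L.flat v).space := Grass.mem_flat.2 (by simpa using ha)
  have hy : v + a + z ∈ (M.flat (v + (a + b + z))).space := by
    rw [Grass.mem_flat]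
    have : v + a + z - (v + (a + b + z)) = -b := by abel
    rw [this]
    exact M.space.neg_mem hb
  have hfeet : explicitFeet (L.flat v) (M.flat (v + (a + b + z))) = (v + a, v + a + z) := by
    rw [← perpFeet_eq_explicitFeet hdet]
    exact (perpFeet_eq_and_flatDist_eq (disjoint_of_subspaceDet_pos hdet) hx hy
      (by simpa using hz)).1
  rw [pairFun, if_pos hdet]
  simp only [hfeet, add_sub_cancel_left]
  congr 2
  rw [midpoint_eq_smul_add, invOf_eq_inv]
  module

theorem lintegral_gauss_add {U : Submodule ℝ (Eucl n)} (c : Eucl n) :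
    ∫⁻ b : U, gauss (U.starProjection c + (b : Eucl n)) = 1 := by
  have h := lintegral_add_left_eq_self (μ := (volume : Measure U)) gauss
    ⟨U.starProjection c, Submodule.starProjection_apply_mem _ _⟩
  rw [lintegral_gauss] at h
  exact h

/-- With `w = v + a + b + z`, where `a ∈ L`, `b ∈ M` and `z ⊥ L + M`, the common perpendicular of
`L + v` and `M + w` starts at `v + a` and is `z`. Hence the coordinate `b` can be integrated out. -/
theorem lintegral_pairFun_snd {G : Eucl n × Eucl n → ℝ≥0∞} (hG : Measurable G) {L M : Grass n k}
    (h : 0 < subspaceDet L.space M.space) (v : Eucl n) :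
    ∫⁻ w, pairFun G (L.flat v, M.flat w) * gauss (M.proj w) =
      ENNReal.ofReal (subspaceDet L.space M.space) *
        ∫⁻ a : L.space, ∫⁻ z : ↥(L.space ⊔ M.space)ᗮ, G (v + a + (2⁻¹ : ℝ) • (z : Eucl n), z) := by
  have hm : Measurable fun w => pairFun G (L.flat v, M.flat w) * gauss (M.proj w) :=
    M.measurable_flat_gauss (f := fun F => pairFun G (L.flat v, F))
      ((measurable_pairFun hG).comp measurable_prodMk_left)
  have hm' : Measurable fun w => pairFun G (L.flat v, M.flat (v + w)) * gauss (M.proj (v + w)) :=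
    hm.comp (measurable_const_add v)
  have hm2 : Measurable fun p : Eucl n × ↥(L.space ⊔ M.space)ᗮ =>
      pairFun G (L.flat v, M.flat (v + (p.1 + p.2))) * gauss (M.proj (v + (p.1 + p.2))) :=
    hm'.comp (by fun_prop : Measurable fun p : Eucl n × ↥(L.space ⊔ M.space)ᗮ =>
      p.1 + (p.2 : Eucl n))
  rw [← lintegral_add_left_eq_self _ v, lintegral_eq_lintegral_orthogonal (L.space ⊔ M.space) _ hm',
    lintegral_sup h _ hm2.lintegral_prod_right']
  congr 1
  refine lintegral_congr fun a => ?_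
  have hG' : Measurable fun z : ↥(L.space ⊔ M.space)ᗮ =>
      G (v + a + (2⁻¹ : ℝ) • (z : Eucl n), z) := by fun_prop
  have hpt : ∀ (b : M.space) (z : ↥(L.space ⊔ M.space)ᗮ),
      pairFun G (L.flat v, M.flat (v + ((a : Eucl n) + b + z))) *
        gauss (M.proj (v + ((a : Eucl n) + b + z))) =
      gauss (M.proj (v + a) + (b : Eucl n)) * G (v + a + (2⁻¹ : ℝ) • (z : Eucl n), z) := by
    intro b z
    rw [pairFun_flat_flat h v a.2 b.2 z.2, mul_comm]
    have h1 : M.proj (b : Eucl n) = b := Submodule.starProjection_eq_self_iff.2 b.2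
    have h2 : M.proj (z : Eucl n) = 0 := (Submodule.starProjection_apply_eq_zero_iff _).2
      (Submodule.orthogonal_le le_sup_right z.2)
    congr 2
    simp only [map_add, h1, h2]
    abel
  simp_rw [hpt]
  simp_rw [lintegral_const_mul _ hG']
  have hmg : Measurable fun b : M.space => gauss (M.proj (v + a) + (b : Eucl n)) :=
    measurable_gauss.comp (by fun_prop)
  rw [lintegral_mul_const _ hmg]
  have h3 := lintegral_gauss_add (U := M.space) (v + a)
  change ∫⁻ b : M.space, gauss (M.proj (v + a) + (b : Eucl n)) = 1 at h3
  rw [h3, one_mul]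

/-- For directions `L`, `M` in general position, the midpoint and the difference vector of the
closest points of `L + v` and `M + w` are distributed, up to the factor `[L, M]`, according to the
Lebesgue measures of `ℝⁿ` and of `(L + M)ᗮ`. -/
theorem lintegral_pairFun {G : Eucl n × Eucl n → ℝ≥0∞} (hG : Measurable G) {L M : Grass n k}
    (h : 0 < subspaceDet L.space M.space) :
    ∫⁻ v, (∫⁻ w, pairFun G (L.flat v, M.flat w) * gauss (M.proj w)) * gauss (L.proj v) =
      ENNReal.ofReal (subspaceDet L.space M.space) *
        ∫⁻ z : ↥(L.space ⊔ M.space)ᗮ, ∫⁻ m, G (m, z) := by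
  set N := (L.space ⊔ M.space)ᗮ
  let K : Eucl n → ℝ≥0∞ := fun x => ∫⁻ z : N, G (x + (2⁻¹ : ℝ) • (z : Eucl n), z)
  have hGK : Measurable fun p : Eucl n × N => G (p.1 + (2⁻¹ : ℝ) • (p.2 : Eucl n), p.2) := by
    fun_prop
  have hK : Measurable K := hGK.lintegral_prod_right'
  have hP : Measurable fun v : Eucl n => L.proj v := L.proj.continuous.measurable
  have hg : Measurable fun v : Eucl n => gauss (L.proj v) := measurable_gauss.comp hP
  simp_rw [lintegral_pairFun_snd hG h, mul_assoc]
  have hKadd : Measurable fun p : Eucl n × L.space => K (p.1 + p.2) := by fun_prop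
  have hm0 : Measurable fun v => (∫⁻ a : L.space, K (v + a)) * gauss (L.proj v) :=
    hKadd.lintegral_prod_right'.mul hg
  refine (lintegral_const_mul _ hm0).trans ?_
  congr 1
  have hm1 : Measurable fun p : Eucl n × L.space => K (p.1 + p.2) * gauss (L.proj p.1) :=
    hKadd.mul (hg.comp measurable_fst)
  have hm2 : Measurable fun p : L.space × Eucl n =>
      K p.2 * gauss (L.proj p.2 + ((-p.1 : L.space) : Eucl n)) :=
    (hK.comp measurable_snd).mul (measurable_gauss.comp
      ((hP.comp measurable_snd).add (measurable_subtype_coe.comp measurable_fst.neg)))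
  calc ∫⁻ v, (∫⁻ a : L.space, K (v + a)) * gauss (L.proj v)
      = ∫⁻ v, ∫⁻ a : L.space, K (v + a) * gauss (L.proj v) := by
        refine lintegral_congr fun v => ?_
        exact (lintegral_mul_const _ (hKadd.comp (measurable_prodMk_left (x := v)))).symm
    _ = ∫⁻ a : L.space, ∫⁻ v, K (v + a) * gauss (L.proj v) :=
        lintegral_lintegral_swap hm1.aemeasurable
    _ = ∫⁻ a : L.space, ∫⁻ v, K v * gauss (L.proj v + ((-a : L.space) : Eucl n)) := by
        refine lintegral_congr fun a => ?_
        rw [← lintegral_add_right_eq_self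
          (fun v => K v * gauss (L.proj v + ((-a : L.space) : Eucl n))) (a : Eucl n)]
        refine lintegral_congr fun v => ?_
        have h1 : L.proj (a : Eucl n) = a := Submodule.starProjection_eq_self_iff.2 a.2
        rw [map_add, h1]
        simp
    _ = ∫⁻ v, ∫⁻ a : L.space, K v * gauss (L.proj v + ((-a : L.space) : Eucl n)) :=
        lintegral_lintegral_swap hm2.aemeasurable
    _ = ∫⁻ v, K v := by
        refine lintegral_congr fun v => ?_
        have hmg : Measurable fun a : L.space => gauss (L.proj v + ((-a : L.space) : Eucl n)) :=
          measurable_gauss.comp (by fun_prop)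
        rw [lintegral_const_mul _ hmg]
        have h2 := lintegral_neg_eq_self (μ := (volume : Measure L.space))
          (fun a : L.space => gauss (L.proj v + (a : Eucl n)))
        have h3 := lintegral_gauss_add (U := L.space) v
        rw [h2]
        change ∫⁻ a : L.space, gauss (L.proj v + (a : Eucl n)) = 1 at h3
        rw [h3, mul_one]
    _ = ∫⁻ z : N, ∫⁻ v, G (v + (2⁻¹ : ℝ) • (z : Eucl n), z) :=
        lintegral_lintegral_swap hGK.aemeasurable
    _ = ∫⁻ z : N, ∫⁻ m, G (m, z) := by
        refine lintegral_congr fun z => ?_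
        exact lintegral_add_right_eq_self (fun m => G (m, (z : Eucl n))) _

theorem measurable_lintegral_pairFun_snd {G : Eucl n × Eucl n → ℝ≥0∞} (hG : Measurable G) :
    Measurable fun q : Flat n k × Grass n k =>
      ∫⁻ w, pairFun G (q.1, q.2.flat w) * gauss (q.2.proj w) := by
  have h1 : Measurable fun q : (Flat n k × Grass n k) × Eucl n =>
      (q.1.1, q.1.2.flat q.2) := by fun_prop
  have h2 : Measurable fun q : (Flat n k × Grass n k) × Eucl n => q.1.2.proj q.2 :=
    Measurable.grassProj (f := fun q : (Flat n k × Grass n k) × Eucl n => q.1.2) (g := Prod.snd)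
      (by fun_prop) measurable_snd
  have h3 := ((measurable_pairFun (k := k) hG).comp h1).mul (measurable_gauss.comp h2)
  exact h3.lintegral_prod_right'

theorem measurable_lintegral_pairFun_mul_gauss {G : Eucl n × Eucl n → ℝ≥0∞} (hG : Measurable G) :
    Measurable fun q : (Grass n k × Grass n k) × Eucl n =>
      (∫⁻ w, pairFun G (q.1.1.flat q.2, q.1.2.flat w) * gauss (q.1.2.proj w)) *
        gauss (q.1.1.proj q.2) := by
  have h1 : Measurable fun q : (Grass n k × Grass n k) × Eucl n =>
      (q.1.1.flat q.2, q.1.2) := by fun_prop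
  have h2 : Measurable fun q : (Grass n k × Grass n k) × Eucl n => q.1.1.proj q.2 :=
    Measurable.grassProj (f := fun q : (Grass n k × Grass n k) × Eucl n => q.1.1) (g := Prod.snd)
      (by fun_prop) measurable_snd
  exact ((measurable_lintegral_pairFun_snd hG).comp h1).mul (measurable_gauss.comp h2)

/-- The integral over all flats with the directions `L` and `M`, in general position or not. -/
theorem lintegral_pairFun' {G : Eucl n × Eucl n → ℝ≥0∞} (hG : Measurable G) (L M : Grass n k) :
    ∫⁻ v, (∫⁻ w, pairFun G (L.flat v, M.flat w) * gauss (M.proj w)) * gauss (L.proj v) =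
      ENNReal.ofReal (subspaceDet L.space M.space) *
        ∫⁻ z : ↥(L.space ⊔ M.space)ᗮ, ∫⁻ m, G (m, z) := by
  by_cases h : 0 < subspaceDet L.space M.space
  · exact lintegral_pairFun hG h
  · have h5 : ∀ v w, pairFun G (L.flat v, M.flat w) = 0 := fun v w => by
      rw [pairFun, if_neg (by simpa using h)]
    simp [h5, ENNReal.ofReal_eq_zero.2 (not_lt.1 h)]

theorem lintegral_lintegral_mul_swap {α β : Type*} [MeasurableSpace α] [MeasurableSpace β]
    {μ : Measure α} {ν : Measure β} [SFinite μ] [SFinite ν] {f : α × β → ℝ≥0∞} {g : α → ℝ≥0∞}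
    (hf : Measurable f) (hg : Measurable g) :
    ∫⁻ a, (∫⁻ b, f (a, b) ∂ν) * g a ∂μ = ∫⁻ b, (∫⁻ a, f (a, b) * g a ∂μ) ∂ν := by
  have h : Measurable fun p : α × β => f p * g p.1 := hf.mul (hg.comp measurable_fst)
  rw [← lintegral_lintegral_swap h.aemeasurable]
  exact lintegral_congr fun a => (lintegral_mul_const _ (hf.comp measurable_prodMk_left)).symm

/-! ### Polar coordinates -/

open Classical in
/-- The direction of a vector, with an arbitrary value for the zero vector. -/
def unitDir [Nonempty (USphere n)] (z : Eucl n) : USphere n :=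
  if h : z = 0 then Classical.arbitrary _ else
    ⟨‖z‖⁻¹ • z, by simp [norm_smul, norm_ne_zero_iff.2 h]⟩

theorem coe_unitDir [Nonempty (USphere n)] {z : Eucl n} (h : z ≠ 0) :
    (unitDir z : Eucl n) = ‖z‖⁻¹ • z := by
  simp [unitDir, h]

theorem measurable_unitDir [Nonempty (USphere n)] :
    Measurable (unitDir : Eucl n → USphere n) := by
  classical
  rw [← MeasurableEmbedding.measurable_comp_iff
    (MeasurableEmbedding.subtype_coe Metric.isClosed_sphere.measurableSet)]
  have : (Subtype.val ∘ unitDir : Eucl n → Eucl n) =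
      fun z => if z = 0 then ((Classical.arbitrary (USphere n) : USphere n) : Eucl n)
        else ‖z‖⁻¹ • z := by
    ext1 z
    by_cases h : z = 0 <;> simp [unitDir, h]
  rw [this]
  exact Measurable.ite (measurableSet_singleton _) measurable_const (by fun_prop)

theorem measurable_sphereIncl (U : Submodule ℝ (Eucl n)) : Measurable (sphereIncl U) := by
  refine Measurable.subtype_mk ?_
  fun_prop

theorem volume_polar [Nonempty (USphere n)] (U : Submodule ℝ (Eucl n)) {B : Set ℝ}
    {C : Set (USphere n)} (hB : MeasurableSet B) (hB0 : B ⊆ Set.Ioi 0) (hC : MeasurableSet C) :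
    volume {z : U | ‖z‖ ∈ B ∧ unitDir (z : Eucl n) ∈ C} =
      (∫⁻ t in B, ENNReal.ofReal (t ^ (Module.finrank ℝ U - 1))) * sphMeasure U C := by
  have hmp := Measure.measurePreserving_homeomorphUnitSphereProd (volume : Measure U)
  have hB' : MeasurableSet ((↑) ⁻¹' B : Set (Set.Ioi (0 : ℝ))) := measurable_subtype_coe hB
  have hC' : MeasurableSet (sphereIncl U ⁻¹' C) := measurable_sphereIncl U hC
  have h1 := hmp.measure_preimage (hC'.prod hB').nullMeasurableSet
  rw [(MeasurableEmbedding.subtype_coe (measurableSet_singleton _).compl).comap_apply,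
    Measure.prod_prod] at h1
  have h2 : Measure.volumeIoiPow (Module.finrank ℝ U - 1) ((↑) ⁻¹' B) =
      ∫⁻ t in B, ENNReal.ofReal (t ^ (Module.finrank ℝ U - 1)) := by
    rw [Measure.volumeIoiPow, withDensity_apply _ hB',
      setLIntegral_subtype measurableSet_Ioi _ fun a : ℝ =>
        ENNReal.ofReal (a ^ (Module.finrank ℝ U - 1)), Subtype.image_preimage_coe,
      Set.inter_eq_right.2 hB0]
  rw [h2] at h1
  rw [sphMeasure, Measure.map_apply (measurable_sphereIncl U) hC, mul_comm, ← h1]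
  congr 1
  ext z
  simp only [Set.mem_ofPred_eq, Set.mem_image, Set.mem_preimage, Set.mem_prod]
  constructor
  · rintro ⟨hz1, hz2⟩
    have hz0 : z ≠ 0 := by
      rintro rfl
      simpa using hB0 hz1
    have hz0' : (z : Eucl n) ≠ 0 := by simpa using hz0
    refine ⟨⟨z, hz0⟩, ⟨?_, by simpa using hz1⟩, rfl⟩
    convert hz2 using 1
    ext1
    simp [sphereIncl, coe_unitDir hz0']
  · rintro ⟨⟨y, hy0⟩, ⟨hy1, hy2⟩, rfl⟩
    have hz0' : (y : Eucl n) ≠ 0 := by simpa using hy0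
    refine ⟨by simpa using hy2, ?_⟩
    convert hy1 using 1
    ext1
    simp [sphereIncl, coe_unitDir hz0']

/-! ### The contribution of a single segment -/

/-- The contribution to the set `S` of a segment with midpoint `m` and difference vector `z`: each
of its two unit direction vectors counts one half, and only lengths in `(0, δ]` are admitted. -/
def segWeight [Nonempty (USphere n)] (δ : ℝ) (S : Set (Eucl n × ℝ × USphere n))
    (q : Eucl n × Eucl n) : ℝ≥0∞ :=
  {q : Eucl n × Eucl n | 0 < ‖q.2‖ ∧ ‖q.2‖ ≤ δ}.indicator (fun q =>
    2⁻¹ * (S.indicator 1 (q.1, ‖q.2‖, unitDir q.2) + S.indicator 1 (q.1, ‖q.2‖, -unitDir q.2))) q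

theorem measurable_segWeight [Nonempty (USphere n)] (δ : ℝ) {S : Set (Eucl n × ℝ × USphere n)}
    (hS : MeasurableSet S) : Measurable (segWeight δ S) := by
  have hu := measurable_unitDir (n := n)
  have h1 : MeasurableSet {q : Eucl n × Eucl n | 0 < ‖q.2‖ ∧ ‖q.2‖ ≤ δ} :=
    (measurableSet_lt measurable_const measurable_snd.norm).inter
      (measurableSet_le measurable_snd.norm measurable_const)
  have hS1 : Measurable (S.indicator (1 : Eucl n × ℝ × USphere n → ℝ≥0∞)) :=
    measurable_one.indicator hS
  have hneg : Measurable fun u : USphere n => -u := continuous_neg.measurable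
  refine Measurable.indicator (Measurable.const_mul (Measurable.add ?_ ?_) _) h1
  · exact hS1.comp (by fun_prop)
  · exact hS1.comp (measurable_fst.prodMk (measurable_snd.norm.prodMk
      (hneg.comp (hu.comp measurable_snd))))

/-- A non-degenerate segment contributes its two unit direction vectors. -/
theorem segMeasure_apply [Nonempty (USphere n)] {E F : Flat n k} {S : Set (Eucl n × ℝ × USphere n)}
    (hS : MeasurableSet S) {x y : Eucl n} (hfeet : perpFeet E F = (x, y))
    (hdist : flatDist E F = ‖y - x‖) (hxy : y - x ≠ 0) :
    segMeasure E F S = 2⁻¹ * (S.indicator 1 (midpoint ℝ x y, ‖y - x‖, unitDir (y - x)) +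
      S.indicator 1 (midpoint ℝ x y, ‖y - x‖, -unitDir (y - x))) := by
  have hpos : 0 < ‖y - x‖ := norm_pos_iff.2 hxy
  have hne : unitDir (y - x) ≠ -unitDir (y - x) := by
    intro h
    have h1 := congrArg (Subtype.val : USphere n → Eucl n) h
    rw [coe_neg_sphere, eq_neg_iff_add_eq_zero, ← two_smul ℝ, coe_unitDir hxy, smul_eq_zero,
      smul_eq_zero] at h1
    rcases h1.resolve_left two_ne_zero with h1 | h1
    · exact (inv_pos.2 hpos).ne' h1
    · exact hxy h1
  have hV : {u : USphere n | (u : Eucl n) ∈ segDir E F} =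
      {unitDir (y - x)} ∪ {-unitDir (y - x)} := by
    ext u
    simp only [segDir, hfeet, Set.mem_ofPred_eq, Set.mem_union, Set.mem_singleton_iff,
      Submodule.mem_span_singleton, Subtype.ext_iff, coe_neg_sphere, coe_unitDir hxy]
    constructor
    · rintro ⟨c, hc⟩
      have hu : ‖(u : Eucl n)‖ = 1 := mem_sphere_zero_iff_norm.1 u.2
      rw [← hc, norm_smul, Real.norm_eq_abs] at hu
      rcases abs_cases c with ⟨h, -⟩ | ⟨h, -⟩
      · left
        rw [← hc, ← eq_inv_of_mul_eq_one_left (h ▸ hu)]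
      · right
        rw [← hc, ← eq_inv_of_mul_eq_one_left (h ▸ hu), neg_smul, neg_neg]
    · rintro (h | h)
      · exact ⟨_, h.symm⟩
      · exact ⟨-‖y - x‖⁻¹, by rw [h, neg_smul]⟩
  have hrestrict : Measure.count.restrict {u : USphere n | (u : Eucl n) ∈ segDir E F} =
      Measure.dirac (unitDir (y - x)) + Measure.dirac (-unitDir (y - x)) := by
    rw [hV, Measure.restrict_union (by simp [hne]) (measurableSet_singleton _),
      Measure.restrict_singleton, Measure.restrict_singleton]
    simp
  have hf : Measurable fun u : USphere n => (mid E F, flatDist E F, u) := by fun_prop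
  rw [segMeasure, hrestrict, Measure.smul_apply, smul_eq_mul, Measure.map_apply hf hS,
    Measure.add_apply, Measure.dirac_apply' _ (hf hS), Measure.dirac_apply' _ (hf hS)]
  simp only [mid, hfeet, hdist]
  rfl

/-! ### Pairs of points of a flat process -/

/-- The flats whose distance from the origin has integer part `m`. -/
def shell (n k m : ℕ) : Set (Flat n k) := {F | ⌊‖F.foot‖⌋₊ = m}

theorem measurableSet_shell (m : ℕ) : MeasurableSet (shell n k m) :=
  (Nat.measurable_floor.comp measurable_foot.norm) (measurableSet_singleton m)

theorem shell_subset (m : ℕ) :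
    shell n k m ⊆ {F | F.Hits (Metric.closedBall 0 ((m : ℝ) + 1))} := by
  intro F hF
  have hF : ⌊‖F.foot‖⌋₊ = m := hF
  have h := (Nat.lt_floor_add_one ‖F.foot‖).le
  rw [hF] at h
  exact Flat.hits_closedBall.2 h

theorem pairwise_disjoint_shell : Pairwise (Function.onFun Disjoint (shell n k)) := by
  intro i j hij
  refine Set.disjoint_left.2 fun F hi hj => hij ?_
  exact (show ⌊‖F.foot‖⌋₊ = i from hi).symm.trans hj

theorem iUnion_shell : ⋃ m, shell n k m = Set.univ :=
  Set.eq_univ_of_forall fun F => Set.mem_iUnion.2 ⟨⌊‖F.foot‖⌋₊, rfl⟩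

theorem ne_of_subspaceDet_pos (hk : 1 ≤ k) {E F : Flat n k}
    (h : 0 < subspaceDet E.dir.space F.dir.space) : E ≠ F := by
  rintro rfl
  have h1 := disjoint_self.1 (disjoint_of_subspaceDet_pos h)
  have h2 := E.dir.finrank_eq
  rw [h1, finrank_bot] at h2
  omega

namespace FlatProc

open ProbabilityTheory

variable {Ω : Type*} [MeasurableSpace Ω]

/-- The random counting measure of a flat process, as a kernel. -/
def pointKernel (X : FlatProc Ω n k) : Kernel Ω (Flat n k) :=
  ⟨X.pointMeasure, X.measurable_pointMeasure⟩

theorem exists_pointMeasure_shell (X : FlatProc Ω n k) (ω : Ω) (m : ℕ) :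
    ∃ j : ℕ, X.pointMeasure ω (shell n k m) = j := by
  have hfin : (X.flats ω ∩ shell n k m).Finite :=
    (X.locallyFinite ω _ (isCompact_closedBall 0 ((m : ℝ) + 1))).subset
      fun F hF => ⟨hF.1, shell_subset m hF.2⟩
  refine ⟨hfin.toFinset.card, ?_⟩
  rw [X.pointMeasure_apply ω (measurableSet_shell m), hfin.encard_eq_coe_toFinset_card]
  rfl

/-- The counting measure of a locally finite process is an s-finite kernel: the space of flats and
the probability space are partitioned so that the number of points is bounded on each part. -/
instance (X : FlatProc Ω n k) : IsSFiniteKernel X.pointKernel := by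
  classical
  let T : ℕ → ℕ → Set Ω := fun m j => {ω | X.pointMeasure ω (shell n k m) = j}
  have hset : ∀ m j : ℕ, MeasurableSet (T m j) := fun m j =>
    (Measure.measurable_coe (measurableSet_shell m)).comp X.measurable_pointMeasure
      (measurableSet_singleton (j : ℝ≥0∞))
  let κ : ℕ → ℕ → Kernel Ω (Flat n k) := fun m j =>
    Kernel.piecewise (hset m j) (X.pointKernel.restrict (measurableSet_shell m)) 0
  have hκ : ∀ m j, IsFiniteKernel (κ m j) := by
    refine fun m j => ⟨⟨j, ENNReal.natCast_lt_top j, fun ω => ?_⟩⟩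
    by_cases h : ω ∈ T m j
    · rw [Kernel.piecewise_apply, if_pos h, Kernel.restrict_apply, Measure.restrict_apply_univ]
      exact (show X.pointMeasure ω (shell n k m) = j from h).le
    · rw [Kernel.piecewise_apply, if_neg h]
      simp
  have hsum : X.pointKernel = Kernel.sum fun m => Kernel.sum fun j => κ m j := by
    ext1 ω
    rw [Kernel.sum_apply]
    conv_lhs => rw [← Measure.restrict_univ (μ := X.pointKernel ω), ← iUnion_shell,
      Measure.restrict_iUnion pairwise_disjoint_shell measurableSet_shell]
    congr 1
    ext1 m
    rw [Kernel.sum_apply]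
    obtain ⟨j, hj⟩ := X.exists_pointMeasure_shell ω m
    ext1 B hB
    rw [Measure.sum_apply _ hB, tsum_eq_single j]
    · rw [Kernel.piecewise_apply, if_pos (show ω ∈ T m j from hj), Kernel.restrict_apply]
    · intro i hi
      have hne : ω ∉ T m i := by
        intro h
        have h' : X.pointMeasure ω (shell n k m) = i := h
        rw [hj] at h'
        exact hi (by exact_mod_cast h'.symm)
      rw [Kernel.piecewise_apply, if_neg hne]
      simp
  rw [hsum]
  infer_instance

instance (X : FlatProc Ω n k) (ω : Ω) : SFinite (X.pointMeasure ω) :=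
  inferInstanceAs (SFinite (X.pointKernel ω))

theorem measurable_prod_pointMeasure (X : FlatProc Ω n k) :
    Measurable fun ω => (X.pointMeasure ω).prod (X.pointMeasure ω) := by
  have h := (X.pointKernel ×ₖ X.pointKernel).measurable
  have h2 : ⇑(X.pointKernel ×ₖ X.pointKernel) =
      fun ω => (X.pointMeasure ω).prod (X.pointMeasure ω) := by
    ext1 ω
    rw [Kernel.prod_apply]
    rfl
  rwa [h2] at h

theorem lintegral_pointMeasure (X : FlatProc Ω n k) (ω : Ω) {f : Flat n k → ℝ≥0∞}
    (hf : Measurable f) : ∫⁻ F, f F ∂X.pointMeasure ω = ∑' F, (X.flats ω).indicator f F := by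
  rw [pointMeasure, lintegral_sum_measure, ← tsum_subtype]
  simp only [lintegral_dirac' _ hf]

theorem lintegral_prod_pointMeasure (X : FlatProc Ω n k) (ω : Ω)
    {f : Flat n k × Flat n k → ℝ≥0∞} (hf : Measurable f) :
    ∫⁻ p, f p ∂(X.pointMeasure ω).prod (X.pointMeasure ω) =
      ∑' p, (X.flats ω ×ˢ X.flats ω).indicator f p := by
  rw [lintegral_prod _ hf.aemeasurable, X.lintegral_pointMeasure ω hf.lintegral_prod_right',
    ENNReal.tsum_prod']
  congr 1
  ext1 E
  by_cases hE : E ∈ X.flats ω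
  · rw [Set.indicator_of_mem hE, X.lintegral_pointMeasure ω (f := fun F => f (E, F))
      (hf.comp measurable_prodMk_left)]
    congr 1
    ext1 F
    by_cases hF : F ∈ X.flats ω <;> simp [Set.indicator, hE, hF]
  · simp [Set.indicator, hE]

/-- Off the diagonal, ordered pairs of flats are counted by the product of the counting measure with
itself. -/
theorem encard_offDiag_inter (hk : 1 ≤ k) (X : FlatProc Ω n k) (ω : Ω)
    {S : Set (Flat n k × Flat n k)} (hS : MeasurableSet S)
    (hS' : ∀ p ∈ S, 0 < subspaceDet p.1.dir.space p.2.dir.space) :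
    (((X.flats ω).offDiag ∩ S).encard : ℝ≥0∞) =
      ((X.pointMeasure ω).prod (X.pointMeasure ω)) S := by
  rw [← lintegral_indicator_one hS,
    X.lintegral_prod_pointMeasure ω (measurable_one.indicator hS), ← ENNReal.tsum_set_one,
    tsum_subtype (β := Flat n k × Flat n k) _ (fun _ => (1 : ℝ≥0∞))]
  congr 1
  ext1 p
  by_cases h2 : p ∈ S
  · have h3 := ne_of_subspaceDet_pos hk (hS' p h2)
    have h4 : p ∈ (X.flats ω).offDiag ∩ S ↔ p ∈ X.flats ω ×ˢ X.flats ω :=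
      ⟨fun h => ⟨h.1.1, h.1.2.1⟩, fun h => ⟨⟨h.1, h.2, h3⟩, h2⟩⟩
    by_cases hp : p ∈ X.flats ω ×ˢ X.flats ω
    · rw [Set.indicator_of_mem (h4.2 hp), Set.indicator_of_mem hp, Set.indicator_of_mem h2,
        Pi.one_apply]
    · rw [Set.indicator_of_notMem (mt h4.1 hp), Set.indicator_of_notMem hp]
  · simp [Set.indicator, h2]

/-- Campbell's formula for the pairs of flats in general position of a process of type `(S₂)`. -/
theorem lintegral_lintegral_prod_pointMeasure (hk : 1 ≤ k) (X : FlatProc Ω n k) (P : Measure Ω)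
    (hS2 : X.IsTypeS2 P) {f : Flat n k × Flat n k → ℝ≥0∞} (hf : Measurable f)
    (hf0 : ∀ p, ¬ 0 < subspaceDet p.1.dir.space p.2.dir.space → f p = 0) :
    ∫⁻ ω, (∫⁻ p, f p ∂(X.pointMeasure ω).prod (X.pointMeasure ω)) ∂P =
      ∫⁻ p, f p ∂(X.intensityMeasure P).prod (X.intensityMeasure P) := by
  set D : Set (Flat n k × Flat n k) := {p | 0 < subspaceDet p.1.dir.space p.2.dir.space}
  have hD : MeasurableSet D := measurableSet_subspaceDet_pos
  have hfD : f = D.indicator f := by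
    ext1 p
    by_cases hp : p ∈ D
    · rw [Set.indicator_of_mem hp]
    · rw [Set.indicator_of_notMem hp, hf0 p hp]
  have hmeas : (P.bind fun ω => (X.pointMeasure ω).prod (X.pointMeasure ω)).restrict D =
      ((X.intensityMeasure P).prod (X.intensityMeasure P)).restrict D := by
    ext1 S hS
    rw [Measure.restrict_apply hS, Measure.restrict_apply hS, ← hS2 _ (hS.inter hD),
      Measure.bind_apply (hS.inter hD) X.measurable_prod_pointMeasure.aemeasurable, factorialMoment]
    refine lintegral_congr fun ω => ?_
    rw [X.encard_offDiag_inter hk ω (hS.inter hD) fun p hp => hp.2]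
  rw [← Measure.lintegral_bind X.measurable_prod_pointMeasure.aemeasurable hf.aemeasurable, hfD,
    lintegral_indicator hD, lintegral_indicator hD, hmeas]

end FlatProc

namespace FlatProc

variable {Ω : Type*} [MeasurableSpace Ω]

/-! ### The intensity measure of the proximity process -/

instance (X : FlatProc Ω n k) (P : Measure Ω) [SFinite P] : SFinite (X.intensityMeasure P) :=
  inferInstanceAs (SFinite (P.bind X.pointKernel))

/-- The definition of the intensity without the quotient of extended numbers, `κ_{n-k}` being
positive and finite. -/
theorem kappa_mul_intensity (X : FlatProc Ω n k) (P : Measure Ω) :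
    kappa (n - k) * X.intensity P =
      X.intensityMeasure P {F | F.Hits (Metric.closedBall 0 1)} :=
  ENNReal.mul_div_cancel (kappa_ne_zero _) (kappa_ne_top _)

/-- The directions of the flats hitting the unit ball are distributed according to `Q`, up to
normalization. This also holds if the intensity is zero, when `Q` is arbitrary. -/
theorem map_dir_restrict_intensityMeasure (X : FlatProc Ω n k) (P : Measure Ω)
    (hfin : X.LocallyFiniteIntensity P) {Q : Measure (Grass n k)}
    (hQ : X.IsDirectionalDistribution P Q) :
    ((X.intensityMeasure P).restrict {F | F.Hits (Metric.closedBall 0 1)}).map Flat.dir =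
      (kappa (n - k) * X.intensity P) • Q := by
  set Θ := X.intensityMeasure P
  set H : Set (Flat n k) := {F | F.Hits (Metric.closedBall 0 1)} with hHdef
  rw [X.kappa_mul_intensity P]
  ext1 D hD
  rw [Measure.map_apply measurable_dir hD, Measure.restrict_apply (measurable_dir hD),
    Measure.smul_apply, smul_eq_mul]
  by_cases h0 : Θ H = 0
  · rw [measure_mono_null Set.inter_subset_right h0, h0, zero_mul]
  · have hγ : X.intensity P ≠ 0 := by
      intro h
      have := X.kappa_mul_intensity P
      rw [h, mul_zero] at this
      exact h0 this.symm
    rw [hQ.2 hγ D hD, ENNReal.mul_div_cancel h0 (hfin _ (isCompact_closedBall 0 1)).ne]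
    congr 1
    ext F
    exact and_comm

theorem lintegral_intensityMeasure (X : FlatProc Ω n k) (P : Measure Ω) [SFinite P]
    (hfin : X.LocallyFiniteIntensity P) (hstat : X.WeaklyStationary P) {Q : Measure (Grass n k)}
    (hQ : X.IsDirectionalDistribution P Q) {f : Flat n k → ℝ≥0∞} (hf : Measurable f) :
    ∫⁻ F, f F ∂X.intensityMeasure P =
      X.intensity P * ∫⁻ L, (∫⁻ v, f (L.flat v) * gauss (L.proj v)) ∂Q := by
  have h := kappa_mul_lintegral_eq hstat hf
  rw [X.map_dir_restrict_intensityMeasure P hfin hQ, lintegral_smul_measure, smul_eq_mul,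
    mul_assoc] at h
  exact (ENNReal.mul_right_inj (kappa_ne_zero _) (kappa_ne_top _)).1 h

theorem lintegral_pairFun_prod (X : FlatProc Ω n k) (P : Measure Ω) [SFinite P]
    (hfin : X.LocallyFiniteIntensity P) (hstat : X.WeaklyStationary P) {Q : Measure (Grass n k)}
    (hQ : X.IsDirectionalDistribution P Q) {G : Eucl n × Eucl n → ℝ≥0∞} (hG : Measurable G) :
    ∫⁻ p : Flat n k × Flat n k, pairFun G p
        ∂(X.intensityMeasure P).prod (X.intensityMeasure P) =
      X.intensity P ^ 2 * ∫⁻ L, (∫⁻ M, (ENNReal.ofReal (subspaceDet L.space M.space) *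
        ∫⁻ z : ↥(L.space ⊔ M.space)ᗮ, (∫⁻ m, G (m, z))) ∂Q) ∂Q := by
  have := hQ.1
  have hpair := measurable_pairFun (k := k) hG
  have hI := measurable_lintegral_pairFun_snd (k := k) hG
  have hJ : Measurable fun E : Flat n k =>
      ∫⁻ M, (∫⁻ w, pairFun G (E, M.flat w) * gauss (M.proj w)) ∂Q := hI.lintegral_prod_right'
  rw [lintegral_prod _ hpair.aemeasurable]
  have h1 : ∀ E : Flat n k, ∫⁻ F, pairFun G (E, F) ∂X.intensityMeasure P =
      X.intensity P * ∫⁻ M, (∫⁻ w, pairFun G (E, M.flat w) * gauss (M.proj w)) ∂Q := fun E =>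
    X.lintegral_intensityMeasure P hfin hstat hQ (f := fun F => pairFun G (E, F))
      (hpair.comp measurable_prodMk_left)
  simp_rw [h1]
  rw [lintegral_const_mul _ hJ, X.lintegral_intensityMeasure P hfin hstat hQ hJ, ← mul_assoc,
    ← sq]
  congr 1
  refine lintegral_congr fun L => ?_
  have hswap : Measurable fun q : Eucl n × Grass n k => (L.flat q.1, q.2) := by fun_prop
  have hg : Measurable fun v : Eucl n => gauss (L.proj v) :=
    measurable_gauss.comp L.proj.continuous.measurable
  refine (lintegral_lintegral_mul_swap (hI.comp hswap) hg).trans ?_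
  exact lintegral_congr fun M => lintegral_pairFun' hG L M

/-- The value of the proximity process on a measurable set, as a sum over pairs of flats. -/
theorem segmentProc_apply [Nonempty (USphere n)] (hk : 1 ≤ k) (X : FlatProc Ω n k) (δ : ℝ) (ω : Ω)
    {S : Set (Eucl n × ℝ × USphere n)} (hS : MeasurableSet S) :
    X.segmentProc δ ω S = 2⁻¹ *
      ∫⁻ p, pairFun (segWeight δ S) p ∂(X.pointMeasure ω).prod (X.pointMeasure ω) := by
  rw [X.lintegral_prod_pointMeasure ω (measurable_pairFun (measurable_segWeight δ hS)),
    segmentProc, Measure.smul_apply, smul_eq_mul, Measure.sum_apply _ hS,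
    tsum_subtype (X.closePairs δ ω) fun p => segMeasure p.1 p.2 S]
  congr 2
  ext1 p
  by_cases hp : p ∈ X.flats ω ×ˢ X.flats ω
  · rw [Set.indicator_of_mem hp, pairFun]
    by_cases hdet : 0 < subspaceDet p.1.dir.space p.2.dir.space
    · have hdist := flatDist_eq_norm_explicitFeet hdet
      rw [if_pos hdet, segWeight]
      by_cases hd : 0 < flatDist p.1 p.2 ∧ flatDist p.1 p.2 ≤ δ
      · have hmem : p ∈ X.closePairs δ ω :=
          ⟨⟨hp.1, hp.2, ne_of_subspaceDet_pos hk hdet⟩, hdet, hd⟩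
        rw [Set.indicator_of_mem hmem, Set.indicator_of_mem
          (show _ ∈ {q : Eucl n × Eucl n | 0 < ‖q.2‖ ∧ ‖q.2‖ ≤ δ} by
            simpa only [Set.mem_ofPred_eq, ← hdist] using hd)]
        refine segMeasure_apply hS (perpFeet_eq_explicitFeet hdet) hdist ?_
        rw [← norm_pos_iff, ← hdist]
        exact hd.1
      · rw [Set.indicator_of_notMem (fun h => hd h.2.2), Set.indicator_of_notMem
          (show _ ∉ {q : Eucl n × Eucl n | 0 < ‖q.2‖ ∧ ‖q.2‖ ≤ δ} by
            simpa only [Set.mem_ofPred_eq, ← hdist] using hd)]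
    · rw [if_neg hdet, Set.indicator_of_notMem fun h => hdet h.2.1]
  · rw [Set.indicator_of_notMem hp, Set.indicator_of_notMem fun h => hp ⟨h.1.1, h.1.2.1⟩]

theorem measurable_segmentProc [Nonempty (USphere n)] (hk : 1 ≤ k) (X : FlatProc Ω n k) (δ : ℝ) :
    Measurable (X.segmentProc δ) := by
  refine Measure.measurable_of_measurable_coe _ fun S hS => ?_
  simp_rw [X.segmentProc_apply hk δ _ hS]
  have h := (Measure.measurable_lintegral
    (measurable_pairFun (k := k) (measurable_segWeight δ hS))).comp X.measurable_prod_pointMeasure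
  exact h.const_mul _

/-- The factor `½` in front of `γ²` is the one that accounts for the orderings of a pair. -/
theorem proximityIntensityMeasure_apply [Nonempty (USphere n)] (hk : 1 ≤ k) (X : FlatProc Ω n k)
    (P : Measure Ω) [SFinite P] (hfin : X.LocallyFiniteIntensity P) (hstat : X.WeaklyStationary P)
    (hS2 : X.IsTypeS2 P) {Q : Measure (Grass n k)} (hQ : X.IsDirectionalDistribution P Q) (δ : ℝ)
    {S : Set (Eucl n × ℝ × USphere n)} (hS : MeasurableSet S) :
    X.proximityIntensityMeasure P δ S = X.intensity P ^ 2 / 2 *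
      ∫⁻ L, (∫⁻ M, (ENNReal.ofReal (subspaceDet L.space M.space) *
        ∫⁻ z : ↥(L.space ⊔ M.space)ᗮ, (∫⁻ m, segWeight δ S (m, z))) ∂Q) ∂Q := by
  have hG := measurable_segWeight δ hS
  have hpair := measurable_pairFun (k := k) hG
  rw [proximityIntensityMeasure, Measure.bind_apply hS (X.measurable_segmentProc hk δ).aemeasurable]
  simp_rw [X.segmentProc_apply hk δ _ hS]
  have h : Measurable fun ω => ∫⁻ p, pairFun (segWeight δ S) p
      ∂(X.pointMeasure ω).prod (X.pointMeasure ω) :=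
    (Measure.measurable_lintegral hpair).comp X.measurable_prod_pointMeasure
  rw [lintegral_const_mul _ h, X.lintegral_lintegral_prod_pointMeasure hk P hS2 hpair
    (fun p hp => by rw [pairFun, if_neg hp]), X.lintegral_pairFun_prod P hfin hstat hQ hG,
    ← mul_assoc, ENNReal.div_eq_inv_mul]

end FlatProc

/-! ### Product sets and normalizing constants -/


theorem sphMeasure_univ (U : Submodule ℝ (Eucl n)) {d : ℕ} (hd : Module.finrank ℝ U = d) :
    sphMeasure U Set.univ = omega d := by
  rw [sphMeasure, Measure.map_apply (measurable_sphereIncl U) MeasurableSet.univ, Set.preimage_univ,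
    Measure.toSphere_apply_univ, ← Measure.addHaar_unitClosedBall_eq_addHaar_unitBall,
    volume_closedBall_eq_kappa hd, hd, omega]

theorem finrank_orthogonal_sup {L M : Grass n k} (h : 0 < subspaceDet L.space M.space) :
    Module.finrank ℝ ↥(L.space ⊔ M.space)ᗮ = n - 2 * k := by
  have h1 := (L.space ⊔ M.space).finrank_add_finrank_orthogonal
  have h2 := Submodule.finrank_sup_add_finrank_inf_eq L.space M.space
  rw [(disjoint_of_subspaceDet_pos h).eq_bot, finrank_bot, L.finrank_eq, M.finrank_eq] at h2
  rw [finrank_euclideanSpace_fin] at h1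
  omega

theorem unitDir_neg [Nonempty (USphere n)] {z : Eucl n} (hz : z ≠ 0) :
    unitDir (-z) = -unitDir z := by
  ext1
  rw [coe_neg_sphere, coe_unitDir hz, coe_unitDir (neg_ne_zero.2 hz), norm_neg, smul_neg]

/-- The two unit direction vectors of a segment are interchanged by the reflection `z ↦ -z`, so that
their contributions are values of one function at `z` and at `-z`. -/
theorem segWeight_prod_apply [Nonempty (USphere n)] (δ : ℝ) (A : Set (Eucl n)) (B : Set ℝ)
    (C : Set (USphere n)) (m z : Eucl n) :
    segWeight δ (A ×ˢ (B ×ˢ C)) (m, z) = A.indicator 1 m * (2⁻¹ *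
      ({z : Eucl n | ‖z‖ ∈ B ∩ Set.Ioc 0 δ ∧ unitDir z ∈ C}.indicator 1 z +
        {z : Eucl n | ‖z‖ ∈ B ∩ Set.Ioc 0 δ ∧ unitDir z ∈ C}.indicator 1 (-z))) := by
  classical
  simp only [segWeight, Set.indicator_apply, Set.mem_ofPred_eq, Set.mem_prod,
    Set.mem_inter_iff, Set.mem_Ioc, norm_neg, Pi.one_apply]
  by_cases hz : 0 < ‖z‖ ∧ ‖z‖ ≤ δ
  · rw [unitDir_neg (norm_pos_iff.1 hz.1)]
    by_cases hm : m ∈ A <;> simp [hm, hz]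
  · simp only [hz, and_false, false_and, if_false, add_zero, mul_zero]

/-- The contribution of all segments with difference vectors in `U` to a product set. -/
theorem lintegral_segWeight_prod [Nonempty (USphere n)] (U : Submodule ℝ (Eucl n)) (δ : ℝ)
    {A : Set (Eucl n)} {B : Set ℝ} {C : Set (USphere n)} (hA : MeasurableSet A)
    (hB : MeasurableSet B) (hC : MeasurableSet C) :
    ∫⁻ z : U, ∫⁻ m, segWeight δ (A ×ˢ (B ×ˢ C)) (m, z) =
      volume A * (∫⁻ t in B ∩ Set.Ioc 0 δ, ENNReal.ofReal (t ^ (Module.finrank ℝ U - 1))) *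
        sphMeasure U C := by
  set T : Set (Eucl n) := {z : Eucl n | ‖z‖ ∈ B ∩ Set.Ioc 0 δ ∧ unitDir z ∈ C}
  have hT : MeasurableSet T :=
    (measurable_norm (hB.inter measurableSet_Ioc)).inter (measurable_unitDir hC)
  have hT1 : Measurable (T.indicator (1 : Eucl n → ℝ≥0∞)) := measurable_one.indicator hT
  have hg : Measurable fun z : U => T.indicator (1 : Eucl n → ℝ≥0∞) z :=
    hT1.comp measurable_subtype_coe
  have hvol : ∫⁻ z : U, T.indicator (1 : Eucl n → ℝ≥0∞) z =
      (∫⁻ t in B ∩ Set.Ioc 0 δ, ENNReal.ofReal (t ^ (Module.finrank ℝ U - 1))) *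
        sphMeasure U C := by
    rw [← volume_polar U (hB.inter measurableSet_Ioc) (fun t ht => ht.2.1) hC]
    exact lintegral_indicator_one (measurable_subtype_coe hT)
  have hneg : ∫⁻ z : U, T.indicator (1 : Eucl n → ℝ≥0∞) (-(z : Eucl n)) =
      ∫⁻ z : U, T.indicator (1 : Eucl n → ℝ≥0∞) z :=
    lintegral_neg_eq_self (fun z : U => T.indicator (1 : Eucl n → ℝ≥0∞) z)
  have hgneg : Measurable fun z : U => T.indicator (1 : Eucl n → ℝ≥0∞) (-(z : Eucl n)) :=
    hT1.comp measurable_subtype_coe.neg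
  have hsum : Measurable fun z : U =>
      T.indicator (1 : Eucl n → ℝ≥0∞) (z : Eucl n) + T.indicator 1 (-(z : Eucl n)) := hg.add hgneg
  have hm : ∀ z : U, ∫⁻ m, segWeight δ (A ×ˢ (B ×ˢ C)) (m, z) =
      volume A * (2⁻¹ * (T.indicator 1 (z : Eucl n) + T.indicator 1 (-(z : Eucl n)))) := by
    intro z
    simp_rw [segWeight_prod_apply]
    rw [lintegral_mul_const _ (measurable_one.indicator hA), lintegral_indicator_one hA]
  simp_rw [hm]
  rw [lintegral_const_mul _ (hsum.const_mul _), lintegral_const_mul _ hsum,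
    lintegral_add_left hg, hneg, hvol, ← two_mul, ← mul_assoc 2⁻¹,
    ENNReal.inv_mul_cancel two_ne_zero ENNReal.ofNat_ne_top, one_mul, mul_assoc]

theorem lintegral_Ioc_pow {d : ℕ} (hd : 1 ≤ d) {δ : ℝ} (hδ : 0 < δ) :
    ∫⁻ t in Set.Ioc 0 δ, ENNReal.ofReal (t ^ (d - 1)) = ENNReal.ofReal (δ ^ d) / d := by
  rw [← ofReal_integral_eq_lintegral_ofReal (intervalIntegral.intervalIntegrable_pow _).1,
    ← intervalIntegral.integral_of_le hδ.le, integral_pow]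
  · obtain ⟨e, rfl⟩ := Nat.exists_eq_add_of_le' hd
    have : ((e + 1 : ℕ) : ℝ≥0∞) = ENNReal.ofReal (e + 1) := by
      rw [← Nat.cast_succ, ENNReal.ofReal_natCast]
    rw [this, ← ENNReal.ofReal_div_of_pos (by positivity)]
    simp
  · filter_upwards [ae_restrict_mem measurableSet_Ioc] with t ht
    exact pow_nonneg ht.1.le _

theorem lintegral_segWeight_prod_mul [Nonempty (USphere n)] (L M : Grass n k) (δ : ℝ)
    {A : Set (Eucl n)} {B : Set ℝ} {C : Set (USphere n)} (hA : MeasurableSet A)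
    (hB : MeasurableSet B) (hC : MeasurableSet C) :
    ENNReal.ofReal (subspaceDet L.space M.space) *
        ∫⁻ z : ↥(L.space ⊔ M.space)ᗮ, ∫⁻ m, segWeight δ (A ×ˢ (B ×ˢ C)) (m, z) =
      (volume A * ∫⁻ t in B ∩ Set.Ioc 0 δ, ENNReal.ofReal (t ^ (n - 2 * k - 1))) *
        (ENNReal.ofReal (subspaceDet L.space M.space) * sphMeasure (L.space ⊔ M.space)ᗮ C) := by
  by_cases h : 0 < subspaceDet L.space M.space
  · rw [lintegral_segWeight_prod _ δ hA hB hC, finrank_orthogonal_sup h]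
    ring
  · rw [ENNReal.ofReal_eq_zero.2 (not_lt.1 h)]
    simp

/-- The directional factor for a pair of directions depends measurably on the pair. -/
theorem measurable_subspaceDet_mul_sphMeasure [Nonempty (USphere n)] (hkn : 2 * k < n)
    {C : Set (USphere n)} (hC : MeasurableSet C) :
    Measurable fun q : Grass n k × Grass n k =>
      ENNReal.ofReal (subspaceDet q.1.space q.2.space) *
        sphMeasure (q.1.space ⊔ q.2.space)ᗮ C := by
  -- The factor is a multiple of the measurable integral over the pairs of flats with the given
  -- directions whose midpoint lies in the unit ball and whose distance is at most one.
  have hA : MeasurableSet (Metric.closedBall (0 : Eucl n) 1) :=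
    Metric.isClosed_closedBall.measurableSet
  have hB : MeasurableSet (Set.Ioc (0 : ℝ) 1) := measurableSet_Ioc
  have hG := measurable_segWeight 1 (hA.prod (hB.prod hC))
  have h1 := (measurable_lintegral_pairFun_mul_gauss (k := k) hG).lintegral_prod_right'
    (ν := volume)
  set c : ℝ≥0∞ := volume (Metric.closedBall (0 : Eucl n) 1) *
    ∫⁻ t in Set.Ioc 0 1 ∩ Set.Ioc 0 1, ENNReal.ofReal (t ^ (n - 2 * k - 1)) with hc
  have hI : ∫⁻ t in Set.Ioc (0 : ℝ) 1 ∩ Set.Ioc 0 1, ENNReal.ofReal (t ^ (n - 2 * k - 1)) =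
      1 / (n - 2 * k : ℕ) := by
    rw [Set.inter_self, lintegral_Ioc_pow (by omega) one_pos, one_pow, ENNReal.ofReal_one]
  have hd : ((n - 2 * k : ℕ) : ℝ≥0∞) ≠ 0 := by
    rw [Nat.cast_ne_zero]
    omega
  have hc0 : c ≠ 0 := by
    rw [hc, hI]
    exact mul_ne_zero (kappa_ne_zero n)
      (ENNReal.div_ne_zero.2 ⟨one_ne_zero, ENNReal.natCast_ne_top _⟩)
  have hct : c ≠ ∞ := by
    rw [hc, hI]
    exact ENNReal.mul_ne_top (kappa_ne_top n) (ENNReal.div_ne_top ENNReal.one_ne_top hd)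
  convert h1.const_mul c⁻¹ using 2 with q
  have h2 := (lintegral_pairFun' hG q.1 q.2).trans
    (lintegral_segWeight_prod_mul _ _ _ hA hB hC)
  refine Eq.symm ((congrArg (c⁻¹ * ·) h2).trans ?_)
  simp only [← hc]
  rw [← mul_assoc, ENNReal.inv_mul_cancel hc0 hct, one_mul]

theorem lintegral_lintegral_const_mul {α β : Type*} [MeasurableSpace α] [MeasurableSpace β]
    {μ : Measure α} {ν : Measure β} [SFinite ν] (c : ℝ≥0∞) {f : α × β → ℝ≥0∞}
    (hf : Measurable f) :
    ∫⁻ a, (∫⁻ b, c * f (a, b) ∂ν) ∂μ = c * ∫⁻ a, (∫⁻ b, f (a, b) ∂ν) ∂μ := by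
  rw [← lintegral_const_mul _ hf.lintegral_prod_right']
  exact lintegral_congr fun a => lintegral_const_mul _ (hf.comp measurable_prodMk_left)

theorem meanDetSph_univ (Q : Measure (Grass n k)) :
    meanDetSph Q Set.univ = omega (n - 2 * k) * meanDet Q := by
  have ho : omega (n - 2 * k) ≠ ∞ := ENNReal.mul_ne_top (ENNReal.natCast_ne_top _) (kappa_ne_top _)
  rw [meanDetSph, meanDet, ← lintegral_const_mul' _ _ ho]
  refine lintegral_congr fun L => ?_
  rw [← lintegral_const_mul' _ _ ho]
  refine lintegral_congr fun M => ?_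
  by_cases h : 0 < subspaceDet L.space M.space
  · rw [sphMeasure_univ _ (finrank_orthogonal_sup h), mul_comm]
  · rw [ENNReal.ofReal_eq_zero.2 (not_lt.1 h)]
    simp

namespace FlatProc

variable {Ω : Type*} [MeasurableSpace Ω]

/-- The intensity measure of the proximity process on product sets. -/
theorem proximityIntensityMeasure_prod [Nonempty (USphere n)] (hk : 1 ≤ k) (hkn : 2 * k < n)
    (X : FlatProc Ω n k) (P : Measure Ω) [SFinite P] (hfin : X.LocallyFiniteIntensity P)
    (hstat : X.WeaklyStationary P) (hS2 : X.IsTypeS2 P) {Q : Measure (Grass n k)}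
    (hQ : X.IsDirectionalDistribution P Q) (δ : ℝ) {A : Set (Eucl n)} {B : Set ℝ}
    {C : Set (USphere n)} (hA : MeasurableSet A) (hB : MeasurableSet B) (hC : MeasurableSet C) :
    X.proximityIntensityMeasure P δ (A ×ˢ (B ×ˢ C)) =
      X.intensity P ^ 2 / 2 * volume A *
        (∫⁻ t in B ∩ Set.Ioc 0 δ, ENNReal.ofReal (t ^ (n - 2 * k - 1))) * meanDetSph Q C := by
  have := hQ.1
  have hm := measurable_subspaceDet_mul_sphMeasure hkn hC
  rw [X.proximityIntensityMeasure_apply hk P hfin hstat hS2 hQ δ (hA.prod (hB.prod hC))]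
  have h1 := (lintegral_congr fun L => lintegral_congr fun M =>
    lintegral_segWeight_prod_mul L M δ hA hB hC).trans
      (lintegral_lintegral_const_mul (μ := Q) (ν := Q)
        (volume A * ∫⁻ t in B ∩ Set.Ioc 0 δ, ENNReal.ofReal (t ^ (n - 2 * k - 1))) hm)
  rw [h1, meanDetSph, mul_assoc (X.intensity P ^ 2 / 2), mul_assoc (X.intensity P ^ 2 / 2)]

theorem proximityIntensityMeasure_ball [Nonempty (USphere n)] (hk : 1 ≤ k) (hkn : 2 * k < n)
    (X : FlatProc Ω n k) (P : Measure Ω) [SFinite P] (hfin : X.LocallyFiniteIntensity P)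
    (hstat : X.WeaklyStationary P) (hS2 : X.IsTypeS2 P) {Q : Measure (Grass n k)}
    (hQ : X.IsDirectionalDistribution P Q) {δ : ℝ} (hδ : 0 < δ) {C : Set (USphere n)}
    (hC : MeasurableSet C) :
    X.proximityIntensityMeasure P δ
        (Metric.closedBall (0 : Eucl n) 1 ×ˢ (Set.Ioi (0 : ℝ) ×ˢ C)) =
      X.intensity P ^ 2 / 2 * kappa n *
        (ENNReal.ofReal (δ ^ (n - 2 * k)) / (n - 2 * k : ℕ)) * meanDetSph Q C := by
  rw [X.proximityIntensityMeasure_prod hk hkn P hfin hstat hS2 hQ δ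
    Metric.isClosed_closedBall.measurableSet measurableSet_Ioi hC,
    Set.inter_eq_right.2 Set.Ioc_subset_Ioi_self,
    lintegral_Ioc_pow (by omega) hδ]
  rfl

theorem proximity_eq [Nonempty (USphere n)] (hk : 1 ≤ k) (hkn : 2 * k < n)
    (X : FlatProc Ω n k) (P : Measure Ω) [SFinite P] (hfin : X.LocallyFiniteIntensity P)
    (hstat : X.WeaklyStationary P) (hS2 : X.IsTypeS2 P) {Q : Measure (Grass n k)}
    (hQ : X.IsDirectionalDistribution P Q) {δ : ℝ} (hδ : 0 < δ) :
    X.proximity P δ = X.intensity P ^ 2 / 2 * kappa (n - 2 * k) *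
        ENNReal.ofReal (δ ^ (n - 2 * k)) * meanDet Q := by
  have hd : ((n - 2 * k : ℕ) : ℝ≥0∞) ≠ 0 := by
    rw [Nat.cast_ne_zero]
    omega
  rw [proximity, X.proximityIntensityMeasure_ball hk hkn P hfin hstat hS2 hQ hδ MeasurableSet.univ,
    meanDetSph_univ, omega]
  set d : ℕ := n - 2 * k
  calc X.intensity P ^ 2 / 2 * kappa n * (ENNReal.ofReal (δ ^ d) / d) *
        (d * kappa d * meanDet Q) / kappa n
      = X.intensity P ^ 2 / 2 * kappa d * (ENNReal.ofReal (δ ^ d) / d * d) * meanDet Q *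
          (kappa n / kappa n) := by
        simp only [div_eq_mul_inv]
        ring
    _ = _ := by
        rw [ENNReal.div_mul_cancel hd (ENNReal.natCast_ne_top _),
          ENNReal.div_self (kappa_ne_zero _) (kappa_ne_top _), mul_one]

theorem proximityDirection_eq [Nonempty (USphere n)] (hk : 1 ≤ k) (hkn : 2 * k < n)
    (X : FlatProc Ω n k) (P : Measure Ω) [SFinite P] (hfin : X.LocallyFiniteIntensity P)
    (hstat : X.WeaklyStationary P) (hS2 : X.IsTypeS2 P) {Q : Measure (Grass n k)}
    (hQ : X.IsDirectionalDistribution P Q) {δ : ℝ} (hδ : 0 < δ) (hγ : X.intensity P ≠ 0)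
    {C : Set (USphere n)} (hC : MeasurableSet C) :
    X.proximityDirection P δ C = meanDetSph Q C / (omega (n - 2 * k) * meanDet Q) := by
  have hd : ((n - 2 * k : ℕ) : ℝ≥0∞) ≠ 0 := by
    rw [Nat.cast_ne_zero]
    omega
  have hγ' : X.intensity P ≠ ∞ :=
    ENNReal.div_ne_top (hfin _ (isCompact_closedBall 0 1)).ne (kappa_ne_zero _)
  have hδ0 : ENNReal.ofReal (δ ^ (n - 2 * k)) ≠ 0 := by
    rw [ne_eq, ENNReal.ofReal_eq_zero, not_le]
    positivity
  rw [proximityDirection, X.proximityIntensityMeasure_ball hk hkn P hfin hstat hS2 hQ hδ hC,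
    X.proximityIntensityMeasure_ball hk hkn P hfin hstat hS2 hQ hδ MeasurableSet.univ,
    meanDetSph_univ]
  refine ENNReal.mul_div_mul_left _ _ ?_ ?_
  · exact mul_ne_zero (mul_ne_zero (ENNReal.div_ne_zero.2 ⟨pow_ne_zero _ hγ, ENNReal.ofNat_ne_top⟩)
      (kappa_ne_zero _)) (ENNReal.div_ne_zero.2 ⟨hδ0, ENNReal.natCast_ne_top _⟩)
  · exact ENNReal.mul_ne_top (ENNReal.mul_ne_top (ENNReal.div_ne_top (ENNReal.pow_ne_top hγ')
      two_ne_zero) (kappa_ne_top _)) (ENNReal.div_ne_top ENNReal.ofReal_ne_top hd)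

end FlatProc

end FlatProximity

end

theorem mainTheorem7 {Ω : Type*} [MeasurableSpace Ω] (P : Measure Ω) [IsProbabilityMeasure P]
    {n k : ℕ} (hk : 1 ≤ k) (hkn : 2 * k < n)
    (X : FlatProximity.FlatProc Ω n k)
    (hfin : X.LocallyFiniteIntensity P)
    (hstat : X.WeaklyStationary P)
    (hS2 : X.IsTypeS2 P)
    (Q : Measure (FlatProximity.Grass n k)) (hQ : X.IsDirectionalDistribution P Q)
    (δ : ℝ) (hδ : 0 < δ) :
    -- the proximity process is a random measure
    Measurable (X.segmentProc δ) ∧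
    -- (a) the intensity measure of the proximity process
    (∀ (A : Set (FlatProximity.Eucl n)) (B : Set ℝ) (C : Set (FlatProximity.USphere n)),
      MeasurableSet A → MeasurableSet B → B ⊆ Set.Ioc 0 δ → MeasurableSet C →
      X.proximityIntensityMeasure P δ (A ×ˢ (B ×ˢ C)) =
        X.intensity P ^ 2 / 2 * volume A *
          (∫⁻ t in B, ENNReal.ofReal (t ^ (n - 2 * k - 1))) * FlatProximity.meanDetSph Q C) ∧
    -- (b) the proximity
    X.proximity P δ =
      X.intensity P ^ 2 / 2 * FlatProximity.kappa (n - 2 * k) *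
        ENNReal.ofReal (δ ^ (n - 2 * k)) * FlatProximity.meanDet Q ∧
    -- (c) the directional distribution of the proximity process, and its independence of `δ`
    (X.proximity P δ ≠ 0 →
      (∀ C : Set (FlatProximity.USphere n), MeasurableSet C →
        X.proximityDirection P δ C =
          FlatProximity.meanDetSph Q C /
            (FlatProximity.omega (n - 2 * k) * FlatProximity.meanDet Q)) ∧
      (∀ δ' : ℝ, 0 < δ' → X.proximity P δ' ≠ 0 ∧
        ∀ C : Set (FlatProximity.USphere n), MeasurableSet C →
          X.proximityDirection P δ' C = X.proximityDirection P δ C)) := by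
  have : NeZero n := ⟨by omega⟩
  have : Nonempty (FlatProximity.USphere n) :=
    (NormedSpace.sphere_nonempty.2 zero_le_one).to_subtype
  refine ⟨X.measurable_segmentProc hk δ, ?_, X.proximity_eq hk hkn P hfin hstat hS2 hQ hδ, ?_⟩
  · intro A B C hA hB hBδ hC
    rw [X.proximityIntensityMeasure_prod hk hkn P hfin hstat hS2 hQ δ hA hB hC,
      Set.inter_eq_left.2 hBδ]
  · intro hπ
    have hπ' := hπ
    rw [X.proximity_eq hk hkn P hfin hstat hS2 hQ hδ] at hπ'
    have hγ : X.intensity P ≠ 0 := by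
      intro h
      simp [h] at hπ'
    have hdir : ∀ δ' : ℝ, 0 < δ' → ∀ C : Set (FlatProximity.USphere n), MeasurableSet C →
        X.proximityDirection P δ' C = FlatProximity.meanDetSph Q C /
          (FlatProximity.omega (n - 2 * k) * FlatProximity.meanDet Q) := fun δ' hδ' C hC =>
      X.proximityDirection_eq hk hkn P hfin hstat hS2 hQ hδ' hγ hC
    refine ⟨hdir δ hδ, fun δ' hδ' => ⟨?_, fun C hC => by rw [hdir δ' hδ' C hC, hdir δ hδ C hC]⟩⟩
    rw [X.proximity_eq hk hkn P hfin hstat hS2 hQ hδ']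
    refine mul_ne_zero (mul_ne_zero (left_ne_zero_of_mul (left_ne_zero_of_mul hπ')) ?_)
      (right_ne_zero_of_mul hπ')
    rw [ne_eq, ENNReal.ofReal_eq_zero, not_le]
    positivity
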